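/- Let $\Omega\subset\mathbb{R}^3$ be a compact domain with smooth boundary, with outward unit normal $\eta$ and second fundamental form $\Pi^{\partial\Omega}(X,Y)=\langle D_X\eta,Y\rangle$ for $X,Y$ tangent to $\partial\Omega$, and suppose that $\Omega$ is convex in the sense that $\Pi^{\partial\Omega}(X,X)>0$ for every tangent vector $X\neq 0$ of $\partial\Omega$. Let $\Sigma$ be a compact smooth surface with nonempty boundary, smoothly immersed in $\Omega$ so that $\partial\Sigma$ is exactly the set of points of $\Sigma$ mapped to $\partial\Omega$, and oriented by a smooth unit normal field $N$, with second fundamental form $A$, induced area measure $da$ and boundary length measure $dl$. Suppose that $\Sigma$ is a stable CMC surface with free boundary, that is: (i) the mean curvature of $\Sigma$ is constant; (ii) $\Sigma$ meets $\partial\Omega$ orthogonally along $\partial\Sigma$; (iii) for all $\varphi\in H^1(\Sigma)$ with $\int_\Sigma\varphi\,da=0$, $$Q(\varphi,\varphi)=\int_\Sigma \left(|\nabla\varphi|^2-|A|^2\varphi^2\right)da-\int_{\partial\Sigma}\Pi^{\partial\Omega}(N,N)\,\varphi^2\,dl\ \ge\ 0 .$$ Then $$Q^0(\varphi,\varphi)=\int_\Sigma\left(|\nabla\varphi|^2-|A|^2\varphi^2\right)da\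 \ge\ 0$$ for every $\varphi\in H^1(\Sigma)$ whose trace on $\partial\Sigma$ vanishes, with no condition on $\int_\Sigma\varphi\,da$. -/

import Mathlib

open MeasureTheory Filter Topology Set
open scoped Manifold ContDiff RealInnerProductSpace

noncomputable section

namespace FreeBoundary

/-- The coordinate plane of surface charts. -/
abbrev E2 := EuclideanSpace ℝ (Fin 2)

/-- Euclidean three-space. -/
abbrev E3 := EuclideanSpace ℝ (Fin 3)

/-! ### Smooth compact convex domains of Euclidean three-space -/

/-- `ρ` is a smooth defining function of `Ω`: `Ω = {ρ ≤ 0}` and the gradient of `ρ` does not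
vanish on `{ρ = 0}` (so that `∂Ω = {ρ = 0}` is a smooth surface). -/
structure IsDefiningFunction (ρ : E3 → ℝ) (Ω : Set E3) : Prop where
  smooth : ContDiff ℝ ∞ ρ
  eq_sublevel : Ω = {q | ρ q ≤ 0}
  regular : ∀ q, ρ q = 0 → gradient ρ q ≠ 0

/-- The outward unit normal `η = ∇ρ / |∇ρ|` of `{ρ ≤ 0}`, extended to a neighbourhood of the
boundary; on the boundary it does not depend on the defining function. -/
def outwardNormal (ρ : E3 → ℝ) (q : E3) : E3 := ‖gradient ρ q‖⁻¹ • gradient ρ q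

/-- The second fundamental form `Π(X, Y) = ⟨D_X η, Y⟩` of the boundary with respect to the outward
unit normal. It is used for `X`, `Y` tangent to the boundary only, where it does not depend on
the extension of `η`. -/
def boundaryForm (ρ : E3 → ℝ) (q X Y : E3) : ℝ := ⟪fderiv ℝ (outwardNormal ρ) q X, Y⟫

/-- `Ω` is a compact domain with smooth boundary, with defining function `ρ`, which is convex in
the sense that `Π(X, X) > 0` for all nonzero vectors `X` tangent to `∂Ω`. -/
structure IsSmoothConvexDomain (Ω : Set E3) (ρ : E3 → ℝ) : Prop where
  compact : IsCompact Ω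
  domain : IsConnected (interior Ω)
  defining : IsDefiningFunction ρ Ω
  convex : ∀ q ∈ frontier Ω, ∀ X : E3, ⟪outwardNormal ρ q, X⟫ = 0 → X ≠ 0 →
    0 < boundaryForm ρ q X X

/-! ### Linear algebra of an immersion at a point -/

/-- The coordinate vectors of the plane. -/
def coordVec (i : Fin 2) : E2 := EuclideanSpace.single i 1

/-- The Gram matrix `g i j = ⟨L e_i, L e_j⟩` (first fundamental form). -/
def gram (L : E2 →L[ℝ] E3) : Matrix (Fin 2) (Fin 2) ℝ :=
  Matrix.of fun i j => ⟪L (coordVec i), L (coordVec j)⟫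

/-! ### Geometry of an immersed surface

`M` is a surface with boundary, modelled on the half plane `{y | 0 ≤ y 0}`, and
`x : M → ℝ³` is an immersion. -/

section Surface

variable {M : Type*} [TopologicalSpace M] [ChartedSpace (EuclideanHalfSpace 2) M]

/-- The differential at `p` of a map on the surface; the tangent space at `p` is identified with
the plane through the preferred chart at `p`. -/
def diffAt {F : Type*} [NormedAddCommGroup F] [NormedSpace ℝ F] (f : M → F) (p : M) :
    E2 →L[ℝ] F :=
  mfderiv (𝓡∂ 2) 𝓘(ℝ, F) f p

/-- The gradient `∇φ = ∑ g^{ij} ∂_jφ ∂_i x` of a function in the metric induced by `x`, as a vector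
of Euclidean space tangent to the immersed surface. -/
def surfGrad (x : M → E3) (φ : M → ℝ) (p : M) : E3 :=
  ∑ i, ∑ j, ((gram (diffAt x p))⁻¹ i j * diffAt φ p (coordVec j)) • diffAt x p (coordVec i)

/-- The matrix `h i j = -⟨∂_i N, ∂_j x⟩` of the second fundamental form `A` with respect to `N`. -/
def secondForm (x N : M → E3) (p : M) : Matrix (Fin 2) (Fin 2) ℝ :=
  Matrix.of fun i j => -⟪diffAt N p (coordVec i), diffAt x p (coordVec j)⟫

/-- The mean curvature `H = g^{ij} h_{ij}` (sum of the principal curvatures). -/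
def meanCurvature (x N : M → E3) (p : M) : ℝ :=
  ((gram (diffAt x p))⁻¹ * secondForm x N p).trace

/-- The squared norm `|A|² = g^{ij} h_{jk} g^{kl} h_{li}` of the second fundamental form. -/
def normSqA (x N : M → E3) (p : M) : ℝ :=
  ((gram (diffAt x p))⁻¹ * secondForm x N p *
    ((gram (diffAt x p))⁻¹ * secondForm x N p)).trace

/-- The differential, at the point `y` of the half plane, of `x` read in the chart `e`. -/
def chartDeriv (x : M → E3) (e : OpenPartialHomeomorph M (EuclideanHalfSpace 2)) (y : E2) :
    E2 →L[ℝ] E3 :=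
  fderivWithin ℝ (x ∘ (e.extend (𝓡∂ 2)).symm) (range (𝓡∂ 2)) y

/-- The point `(0, s)` of the boundary line of the half plane. -/
def edgePt (s : ℝ) : E2 := !₂[0, s]

/-- `x` is a smooth immersion of the surface with nonempty boundary `M` into `Ω`, with
`∂M = x⁻¹(∂Ω)`, oriented by the smooth unit normal field `N`. -/
structure IsImmersedSurface (Ω : Set E3) (x N : M → E3) : Prop where
  smooth : ContMDiff (𝓡∂ 2) 𝓘(ℝ, E3) ∞ x
  immersion : ∀ p, Function.Injective (diffAt x p)
  smooth_normal : ContMDiff (𝓡∂ 2) 𝓘(ℝ, E3) ∞ N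
  norm_normal : ∀ p, ‖N p‖ = 1
  normal : ∀ p v, ⟪N p, diffAt x p v⟫ = 0
  mapsTo : ∀ p, x p ∈ Ω
  boundary_nonempty : ((𝓡∂ 2).boundary M).Nonempty
  boundary_iff : ∀ p, p ∈ (𝓡∂ 2).boundary M ↔ x p ∈ frontier Ω

variable [MeasurableSpace M]

/-- The area measure `da` of the domain of the chart `e`: the image of `√(det g) dy` under the
inverse of `e`. -/
def chartArea (x : M → E3) (e : OpenPartialHomeomorph M (EuclideanHalfSpace 2)) : Measure M :=
  (((volume : Measure E2).restrict (e.extend (𝓡∂ 2)).target).withDensity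
    fun y => ENNReal.ofReal √(gram (chartDeriv x e y)).det).map (e.extend (𝓡∂ 2)).symm

/-- The area measure `da` of the metric induced by `x`. The measures `chartArea x e` agree on
overlaps of charts, so their least upper bound is the measure which restricts to each of them. -/
def area (x : M → E3) : Measure M :=
  ⨆ e ∈ atlas (EuclideanHalfSpace 2) M, chartArea x e

/-- The length measure `dl` of the part of `∂M` in the domain of the chart `e`: the image of
`|∂_s x(0, s)| ds` under `s ↦ e⁻¹(0, s)`. -/
def chartLength (x : M → E3) (e : OpenPartialHomeomorph M (EuclideanHalfSpace 2)) : Measure M :=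
  (((volume : Measure ℝ).restrict {s | edgePt s ∈ (e.extend (𝓡∂ 2)).target}).withDensity
    fun s => ENNReal.ofReal ‖chartDeriv x e (edgePt s) (coordVec 1)‖).map
      fun s => (e.extend (𝓡∂ 2)).symm (edgePt s)

/-- The length measure `dl` of `∂M` in the metric induced by `x`, as a measure on `M` carried by
`∂M`; again the local measures agree on overlaps. -/
def bdryLength (x : M → E3) : Measure M :=
  ⨆ e ∈ atlas (EuclideanHalfSpace 2) M, chartLength x e

/-- `φ` belongs to the Sobolev space `H¹` of the surface, with weak gradient `G` and boundary trace
`t`. Here `H¹` is the completion of the functions smooth up to the boundary in the norm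
`(∫ |∇φ|² + φ² da)^(1/2)`, the weak gradient and the trace are the continuous extensions of
`∇` and of the restriction to `∂M`; both are determined by `φ` almost everywhere. -/
structure IsSobolev (x : M → E3) (φ : M → ℝ) (G : M → E3) (t : M → ℝ) : Prop where
  memLp_fun : MemLp φ 2 (area x)
  memLp_grad : MemLp G 2 (area x)
  memLp_trace : MemLp t 2 (bdryLength x)
  approx : ∃ f : ℕ → M → ℝ, (∀ k, ContMDiff (𝓡∂ 2) 𝓘(ℝ, ℝ) ∞ (f k)) ∧
    Tendsto (fun k => eLpNorm (fun p => f k p - φ p) 2 (area x)) atTop (𝓝 0) ∧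
    Tendsto (fun k => eLpNorm (fun p => surfGrad x (f k) p - G p) 2 (area x)) atTop (𝓝 0) ∧
    Tendsto (fun k => eLpNorm (fun p => f k p - t p) 2 (bdryLength x)) atTop (𝓝 0)

/-- The quadratic form `Q⁰(φ, φ) = ∫ |∇φ|² - |A|² φ² da`, for `φ` with gradient `G`. -/
def interiorForm (x N : M → E3) (φ : M → ℝ) (G : M → E3) : ℝ :=
  ∫ p, (‖G p‖ ^ 2 - normSqA x N p * φ p ^ 2) ∂(area x)

/-- The quadratic form `Q(φ, φ) = ∫ |∇φ|² - |A|² φ² da - ∫_∂ Π(N, N) φ² dl`, for `φ` with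
gradient `G` and boundary values `t`. -/
def indexForm (ρ : E3 → ℝ) (x N : M → E3) (φ : M → ℝ) (G : M → E3) (t : M → ℝ) : ℝ :=
  interiorForm x N φ G - ∫ p, boundaryForm ρ (x p) (N p) (N p) * t p ^ 2 ∂(bdryLength x)

/-- The immersed surface is a stable constant mean curvature surface with free boundary in the
domain with defining function `ρ`: the mean curvature is constant, the surface meets the boundary
of the domain orthogonally, and `Q(φ, φ) ≥ 0` for all `φ` in `H¹` of mean zero. -/
structure IsStableCMC (ρ : E3 → ℝ) (x N : M → E3) : Prop where
  const_meanCurvature : ∃ H : ℝ, ∀ p, meanCurvature x N p = H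
  orthogonal : ∀ p ∈ (𝓡∂ 2).boundary M, ⟪N p, outwardNormal ρ (x p)⟫ = 0
  stable : ∀ (φ : M → ℝ) (G : M → E3) (t : M → ℝ), IsSobolev x φ G t →
    ∫ p, φ p ∂(area x) = 0 → 0 ≤ indexForm ρ x N φ G t

end Surface

end FreeBoundary

end

open FreeBoundary

noncomputable section

namespace FreeBoundary

set_option linter.unusedSectionVars false

/-! ### Vector algebra in three-space -/

/-! For a fixed vector `a`, put u = ⟨a, N⟩. Translations preserve the mean curvature, and on a
surface with constant mean curvature u solves the Jacobi equation Δu + |A|²u = 0. Since ∑ₐ |∇⟨eₐ,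
N⟩|² = |A|² and ∑ₐ ⟨eₐ, N⟩² = 1, the interior parts of Q(⟨eₐ, N⟩, ⟨eₐ, N⟩) cancel in the sum over
the three coordinate vectors, which leaves -∫ Π(N, N) dl. Orthogonality makes N tangent to ∂Ω along
∂Σ, so by convexity this is negative, and Q(u, u) < 0 for some `a` (`exists_indexForm_neg`).
Stability then forces ∫ u da ≠ 0.

Given φ with zero trace, choose c such that φ + cu has mean zero. Expanding Q(φ + cu, φ + cu) ≥ 0,
the cross term is the weak Jacobi equation for u tested with φ and vanishes because φ has zero trace
(`integral_jacobi_eq_zero`). The boundary term involves only cu. Hence Q⁰(φ, φ) ≥ -c² Q(u, u) ≥ 0.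

The Jacobi equation is obtained in divergence form. In a chart, with Xᵢ = ∂ᵢx and Nᵢ = ∂ᵢN, let Pᵢ =
det(a, N, H Xᵢ + Nᵢ) (`flux`). Up to the orientation sign, √g ⟨∇f, ∇u⟩ = ∂₀f P₁ - ∂₁f P₀
(`triple_mul_inner_gradOf`) and ∂₀P₁ - ∂₁P₀ = -√g |A|² u (`triple_mul_normSqOf`). The second
identity needs only that H is constant and that second derivatives of x and N are symmetric; the
Codazzi equations do not appear explicitly. The divergence theorem in the half plane turns the weak
form into an edge integral of f P₁. This edge integral need not be identified with a conormal
derivative: a partition of unity gives the bound C ∫ |f| dl for smooth f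
(`exists_jacobiForm_bound`), and the bound passes to the limit in H¹, where the trace is zero. -/

theorem inner_eq_coords (u v : E3) : ⟪u, v⟫ = u 0 * v 0 + u 1 * v 1 + u 2 * v 2 := by
  simp [PiLp.inner_apply, Fin.sum_univ_three]; ring

/-- The triple product `⟨a, u × v⟩` as a bilinear map in `u` and `v`. -/
def triple (a : E3) : E3 →L[ℝ] E3 →L[ℝ] ℝ :=
  (LinearMap.mk₂ ℝ (fun u v : E3 => a 0 * (u 1 * v 2 - u 2 * v 1) + a 1 * (u 2 * v 0 - u 0 * v 2)
      + a 2 * (u 0 * v 1 - u 1 * v 0))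
    (fun _ _ _ => by simp only [PiLp.add_apply]; ring)
    (fun _ _ _ => by simp only [PiLp.smul_apply, smul_eq_mul]; ring)
    (fun _ _ _ => by simp only [PiLp.add_apply]; ring)
    (fun _ _ _ => by simp only [PiLp.smul_apply, smul_eq_mul]; ring)).toContinuousBilinearMap

theorem triple_apply (a u v : E3) : triple a u v =
    a 0 * (u 1 * v 2 - u 2 * v 1) + a 1 * (u 2 * v 0 - u 0 * v 2)
      + a 2 * (u 0 * v 1 - u 1 * v 0) := rfl

theorem triple_swap (a u v : E3) : triple a u v = -triple a v u := by
  simp only [triple_apply]; ring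

/-- The triple product with the normal, for `n` a unit normal of the plane of `u` and `v`. -/
theorem triple_eq_mul_inner {n u v : E3} (hn : ‖n‖ = 1) (hu : ⟪n, u⟫ = 0) (hv : ⟪n, v⟫ = 0)
    (a : E3) : triple a u v = triple n u v * ⟪n, a⟫ := by
  have h1 : ⟪n, n⟫ = 1 := by rw [real_inner_self_eq_norm_sq, hn]; norm_num
  rw [inner_eq_coords] at h1 hu hv
  -- This is the linear relation between the four vectors a, n, u, v of three-space, paired with n.
  -- It says that u × v is parallel to n.
  have key : triple a u v * (n 0 * n 0 + n 1 * n 1 + n 2 * n 2) - triple n u v * ⟪n, a⟫ =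
      (n 0 * u 0 + n 1 * u 1 + n 2 * u 2) * triple a n v
        - (n 0 * v 0 + n 1 * v 1 + n 2 * v 2) * triple a n u := by
    simp only [triple_apply, inner_eq_coords]; ring
  rw [h1, hu, hv] at key
  linarith

/-- Taking coordinate vectors for `a` in `triple_eq_mul_inner` gives u × v = D n with D = det(n, u,
v). The claim is then Lagrange's identity for |u × v|². -/
theorem triple_normal_sq {n u v : E3} (hn : ‖n‖ = 1) (hu : ⟪n, u⟫ = 0) (hv : ⟪n, v⟫ = 0) :
    triple n u v ^ 2 = ⟪u, u⟫ * ⟪v, v⟫ - ⟪u, v⟫ ^ 2 := by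
  have h0 := triple_eq_mul_inner hn hu hv (EuclideanSpace.single 0 1)
  have h1 := triple_eq_mul_inner hn hu hv (EuclideanSpace.single 1 1)
  have h2 := triple_eq_mul_inner hn hu hv (EuclideanSpace.single 2 1)
  have hnn : ⟪n, n⟫ = 1 := by rw [real_inner_self_eq_norm_sq, hn]; norm_num
  generalize triple n u v = D at *
  simp [triple_apply, inner_eq_coords] at h0 h1 h2
  simp only [inner_eq_coords] at hnn ⊢
  have : D ^ 2 = (D * n 0) ^ 2 + (D * n 1) ^ 2 + (D * n 2) ^ 2 := by
    linear_combination (-D ^ 2) * hnn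
  rw [this, ← h0, ← h1, ← h2]
  ring

/-- Since D n = u × v, this is the double vector product (u × v) × u = |u|² v - ⟨u, v⟩ u paired with
`a`. -/
theorem triple_normal_left {n u v : E3} (hn : ‖n‖ = 1) (hu : ⟪n, u⟫ = 0) (hv : ⟪n, v⟫ = 0)
    (a : E3) : triple n u v * triple a n u = ⟪u, u⟫ * ⟪v, a⟫ - ⟪u, v⟫ * ⟪u, a⟫ := by
  have h0 := triple_eq_mul_inner hn hu hv (EuclideanSpace.single 0 1)
  have h1 := triple_eq_mul_inner hn hu hv (EuclideanSpace.single 1 1)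
  have h2 := triple_eq_mul_inner hn hu hv (EuclideanSpace.single 2 1)
  generalize triple n u v = D at *
  simp [triple_apply, inner_eq_coords] at h0 h1 h2
  simp only [triple_apply, inner_eq_coords]
  linear_combination (-(a 1 * u 2 - a 2 * u 1)) * (-h0) + (a 2 * u 0 - a 0 * u 2) * h1
    + (a 0 * u 1 - a 1 * u 0) * h2

theorem triple_normal_right {n u v : E3} (hn : ‖n‖ = 1) (hu : ⟪n, u⟫ = 0) (hv : ⟪n, v⟫ = 0)
    (a : E3) : triple n u v * triple a n v = ⟪u, v⟫ * ⟪v, a⟫ - ⟪v, v⟫ * ⟪u, a⟫ := by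
  have h := triple_normal_left hn hv hu a
  rw [triple_swap n v u, real_inner_comm u v] at h
  linarith

/-! ### Linear algebra of an immersion at a point -/

/-- The gradient with respect to the metric induced by `L` of a linear form. -/
def gradOf (L : E2 →L[ℝ] E3) (l : E2 →L[ℝ] ℝ) : E3 :=
  ∑ i, ∑ j, ((gram L)⁻¹ i j * l (coordVec j)) • L (coordVec i)

/-- The second fundamental form of an immersion with differential `L` and Gauss map with
differential `K`. -/
def formOf (L K : E2 →L[ℝ] E3) : Matrix (Fin 2) (Fin 2) ℝ :=
  Matrix.of fun i j => -⟪K (coordVec i), L (coordVec j)⟫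

/-- The mean curvature in terms of the differentials of the immersion and of the Gauss map. -/
def meanOf (L K : E2 →L[ℝ] E3) : ℝ := ((gram L)⁻¹ * formOf L K).trace

/-- The squared norm of the second fundamental form in terms of the differentials. -/
def normSqOf (L K : E2 →L[ℝ] E3) : ℝ :=
  ((gram L)⁻¹ * formOf L K * ((gram L)⁻¹ * formOf L K)).trace

/-- The matrix of a linear map of the plane. -/
def matOf (B : E2 →L[ℝ] E2) : Matrix (Fin 2) (Fin 2) ℝ :=
  LinearMap.toMatrix (EuclideanSpace.basisFun (Fin 2) ℝ).toBasis
    (EuclideanSpace.basisFun (Fin 2) ℝ).toBasis B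

theorem det_matOf (B : E2 →L[ℝ] E2) : (matOf B).det = B.det :=
  LinearMap.det_toMatrix _ _

theorem eq_sum_coordVec (v : E2) : v = v 0 • coordVec 0 + v 1 • coordVec 1 := by
  ext i; fin_cases i <;> simp [coordVec]

theorem apply_coordVec (B : E2 →L[ℝ] E2) (i : Fin 2) :
    B (coordVec i) = ∑ k, matOf B k i • coordVec k := by
  have h : ∀ k, matOf B k i = B (coordVec i) k := fun k => by
    simp [matOf, LinearMap.toMatrix_apply, coordVec]
  rw [Fin.sum_univ_two, h, h]
  exact eq_sum_coordVec _

theorem gram_comp (L : E2 →L[ℝ] E3) (B : E2 →L[ℝ] E2) :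
    gram (L.comp B) = (matOf B).transpose * gram L * matOf B := by
  ext i j
  simp only [gram, Matrix.of_apply, ContinuousLinearMap.comp_apply, apply_coordVec, Matrix.mul_apply,
    Matrix.transpose_apply, Fin.sum_univ_two, map_add, map_smul, inner_add_left, inner_add_right,
    real_inner_smul_left, real_inner_smul_right]
  ring

theorem formOf_comp (L K : E2 →L[ℝ] E3) (B : E2 →L[ℝ] E2) :
    formOf (L.comp B) (K.comp B) = (matOf B).transpose * formOf L K * matOf B := by
  ext i j
  simp only [formOf, Matrix.of_apply, ContinuousLinearMap.comp_apply, apply_coordVec,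
    Matrix.mul_apply, Matrix.transpose_apply, Fin.sum_univ_two, map_add, map_smul, inner_add_left,
    inner_add_right, real_inner_smul_left, real_inner_smul_right]
  ring

theorem gram_det (L : E2 →L[ℝ] E3) : (gram L).det =
    ⟪L (coordVec 0), L (coordVec 0)⟫ * ⟪L (coordVec 1), L (coordVec 1)⟫
      - ⟪L (coordVec 0), L (coordVec 1)⟫ ^ 2 := by
  rw [Matrix.det_fin_two]
  simp only [gram, Matrix.of_apply]
  rw [real_inner_comm (L (coordVec 0)) (L (coordVec 1))]; ring

theorem coordVec_ne_zero (i : Fin 2) : coordVec i ≠ 0 := by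
  simp [coordVec]

/-- The Gram–Schmidt vector |X|² Y - ⟨X, Y⟩ X is nonzero by injectivity, and its squared norm is
|X|² times the determinant. -/
theorem gram_det_pos {L : E2 →L[ℝ] E3} (hL : Function.Injective L) : 0 < (gram L).det := by
  rw [gram_det]
  set X := L (coordVec 0)
  set Y := L (coordVec 1)
  have hX : 0 < ⟪X, X⟫ := real_inner_self_pos.2
    (fun h => coordVec_ne_zero 0 (hL (by rw [map_zero]; exact h)))
  have hw : ⟪X, X⟫ • Y - ⟪X, Y⟫ • X ≠ 0 := by
    intro h
    have : L (⟪X, X⟫ • coordVec 1 - ⟪X, Y⟫ • coordVec 0) = L 0 := by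
      rw [map_sub, map_smul, map_smul, map_zero]; exact h
    have h1 := congrArg (fun v : E2 => v 1) (hL this)
    simp [coordVec] at h1
    rw [h1] at hX
    simp at hX
  have h2 : 0 < ⟪⟪X, X⟫ • Y - ⟪X, Y⟫ • X, ⟪X, X⟫ • Y - ⟪X, Y⟫ • X⟫ := real_inner_self_pos.2 hw
  have h3 : ⟪⟪X, X⟫ • Y - ⟪X, Y⟫ • X, ⟪X, X⟫ • Y - ⟪X, Y⟫ • X⟫ =
      ⟪X, X⟫ * (⟪X, X⟫ * ⟪Y, Y⟫ - ⟪X, Y⟫ ^ 2) := by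
    simp only [inner_sub_left, inner_sub_right, real_inner_smul_left, real_inner_smul_right,
      real_inner_comm X Y]
    ring
  rw [h3] at h2
  exact pos_of_mul_pos_right h2 hX.le

theorem isUnit_gram_det {L : E2 →L[ℝ] E3} (hL : Function.Injective L) : IsUnit (gram L).det :=
  (gram_det_pos hL).ne'.isUnit

theorem gram_symm (L : E2 →L[ℝ] E3) (i j : Fin 2) : gram L i j = gram L j i :=
  real_inner_comm (L (coordVec j)) (L (coordVec i))

/-- The gradient as the image of a vector of the plane. -/
theorem gradOf_eq_apply (L : E2 →L[ℝ] E3) (l : E2 →L[ℝ] ℝ) :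
    gradOf L l = L (∑ i, (∑ j, (gram L)⁻¹ i j * l (coordVec j)) • coordVec i) := by
  simp [gradOf, add_smul]

theorem inner_gradOf {L : E2 →L[ℝ] E3} (hL : Function.Injective L) (l : E2 →L[ℝ] ℝ) (v : E2) :
    ⟪gradOf L l, L v⟫ = l v := by
  have key : ∀ k, ⟪gradOf L l, L (coordVec k)⟫ = l (coordVec k) := by
    intro k
    have h1 : ⟪gradOf L l, L (coordVec k)⟫ =
        ∑ j, (gram L * (gram L)⁻¹) k j * l (coordVec j) := by
      simp only [gradOf, Fin.sum_univ_two, inner_add_left, real_inner_smul_left, Matrix.mul_apply]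
      have : ∀ i, ⟪L (coordVec i), L (coordVec k)⟫ = gram L k i := fun i => gram_symm L i k
      simp only [this]; ring
    rw [h1, Matrix.mul_nonsing_inv _ (isUnit_gram_det hL)]
    simp [Matrix.one_apply]
  rw [eq_sum_coordVec v]
  simp only [map_add, map_smul, inner_add_right, real_inner_smul_right, key, smul_eq_mul]

theorem eq_gradOf {L : E2 →L[ℝ] E3} (hL : Function.Injective L) (l : E2 →L[ℝ] ℝ) {w : E2}
    (h : ∀ v, ⟪L w, L v⟫ = l v) : L w = gradOf L l := by
  rw [gradOf_eq_apply]
  set w' := ∑ i, (∑ j, (gram L)⁻¹ i j * l (coordVec j)) • coordVec i with hw'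
  have h2 : ∀ v, ⟪L w', L v⟫ = l v := fun v => by
    rw [hw', ← gradOf_eq_apply]; exact inner_gradOf hL l v
  rw [← sub_eq_zero, ← inner_self_eq_zero (𝕜 := ℝ), ← map_sub]
  nth_rewrite 1 [map_sub]
  rw [inner_sub_left, h, h2, sub_self]

/-- The gradient is the tangent vector representing the linear form, a description free of
coordinates. Surjectivity of `B` lets every test vector be pulled back. -/
theorem gradOf_comp {L : E2 →L[ℝ] E3} {B : E2 →L[ℝ] E2} (hL : Function.Injective L)
    (hB : B.det ≠ 0) (l : E2 →L[ℝ] ℝ) : gradOf (L.comp B) (l.comp B) = gradOf L l := by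
  have hsurj : Function.Surjective B := (LinearMap.equivOfDetNeZero (B : E2 →ₗ[ℝ] E2) hB).surjective
  have hinj : Function.Injective B := (LinearMap.equivOfDetNeZero (B : E2 →ₗ[ℝ] E2) hB).injective
  rw [gradOf_eq_apply (L.comp B)]
  set w := ∑ i, (∑ j, (gram (L.comp B))⁻¹ i j * (l.comp B) (coordVec j)) • coordVec i with hw
  refine eq_gradOf hL l (w := B w) fun v => ?_
  obtain ⟨v', rfl⟩ := hsurj v
  have := inner_gradOf (L := L.comp B) (hL.comp hinj) (l.comp B) v'
  rwa [gradOf_eq_apply, ← hw] at this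

theorem inner_gradOf_gradOf {L : E2 →L[ℝ] E3} (hL : Function.Injective L) (l k : E2 →L[ℝ] ℝ) :
    ⟪gradOf L l, gradOf L k⟫ = ∑ i, ∑ j, (gram L)⁻¹ i j * (l (coordVec i) * k (coordVec j)) := by
  rw [gradOf_eq_apply L k, inner_gradOf hL]
  simp only [Fin.sum_univ_two, map_add, map_smul, smul_eq_mul]
  ring

/-- Both fundamental forms change by congruence, hence the shape operator by conjugation. Its trace
and the trace of its square are therefore independent of the chart. -/
theorem shape_comp (L K : E2 →L[ℝ] E3) {B : E2 →L[ℝ] E2} (hB : B.det ≠ 0) :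
    (gram (L.comp B))⁻¹ * formOf (L.comp B) (K.comp B) =
      (matOf B)⁻¹ * ((gram L)⁻¹ * formOf L K) * matOf B := by
  have hb : IsUnit (matOf B).transpose.det := by
    rw [Matrix.det_transpose, det_matOf]; exact hB.isUnit
  rw [gram_comp, formOf_comp, Matrix.mul_inv_rev, Matrix.mul_inv_rev]
  simp only [Matrix.mul_assoc]
  rw [← Matrix.mul_assoc ((matOf B).transpose)⁻¹, Matrix.nonsing_inv_mul _ hb, Matrix.one_mul]

theorem meanOf_comp (L K : E2 →L[ℝ] E3) {B : E2 →L[ℝ] E2} (hB : B.det ≠ 0) :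
    meanOf (L.comp B) (K.comp B) = meanOf L K := by
  have hb : IsUnit (matOf B).det := by rw [det_matOf]; exact hB.isUnit
  rw [meanOf, shape_comp L K hB, Matrix.mul_assoc, Matrix.trace_mul_comm, Matrix.mul_assoc,
    Matrix.mul_nonsing_inv _ hb, Matrix.mul_one, meanOf]

theorem normSqOf_comp (L K : E2 →L[ℝ] E3) {B : E2 →L[ℝ] E2} (hB : B.det ≠ 0) :
    normSqOf (L.comp B) (K.comp B) = normSqOf L K := by
  have hb : IsUnit (matOf B).det := by rw [det_matOf]; exact hB.isUnit
  rw [normSqOf, shape_comp L K hB, normSqOf]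
  set S := (gram L)⁻¹ * formOf L K
  have : (matOf B)⁻¹ * S * matOf B * ((matOf B)⁻¹ * S * matOf B) =
      (matOf B)⁻¹ * (S * S * matOf B) := by
    simp only [Matrix.mul_assoc]
    rw [← Matrix.mul_assoc (matOf B) (matOf B)⁻¹, Matrix.mul_nonsing_inv _ hb, Matrix.one_mul]
  rw [this, Matrix.trace_mul_comm, Matrix.mul_assoc, Matrix.mul_nonsing_inv _ hb, Matrix.mul_one]

theorem sqrt_gram_det_comp (L : E2 →L[ℝ] E3) (B : E2 →L[ℝ] E2) :
    √(gram (L.comp B)).det = |B.det| * √(gram L).det := by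
  rw [gram_comp, Matrix.det_mul, Matrix.det_mul, Matrix.det_transpose, det_matOf,
    show B.det * (gram L).det * B.det = B.det ^ 2 * (gram L).det by ring,
    Real.sqrt_mul (sq_nonneg _), Real.sqrt_sq_eq_abs]

/-! ### Identities for the Gauss map at a point -/

section GaussMap

variable {L K : E2 →L[ℝ] E3} {n : E3}

theorem triple_normal_sq_eq_det (hn : ‖n‖ = 1) (hnL : ∀ v, ⟪n, L v⟫ = 0) :
    triple n (L (coordVec 0)) (L (coordVec 1)) ^ 2 = (gram L).det := by
  rw [triple_normal_sq hn (hnL _) (hnL _), gram_det]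

/-- The Weingarten equations: the derivatives of the Gauss map are tangent. -/
theorem exists_weingarten (hL : Function.Injective L) (hn : ‖n‖ = 1) (hnL : ∀ v, ⟪n, L v⟫ = 0)
    (hnK : ∀ v, ⟪n, K v⟫ = 0) : ∃ S : Matrix (Fin 2) (Fin 2) ℝ, ∀ i,
      K (coordVec i) = S i 0 • L (coordVec 0) + S i 1 • L (coordVec 1) := by
  have hD2 := triple_normal_sq_eq_det hn hnL
  have hpos := gram_det_pos hL
  have hD : triple n (L (coordVec 0)) (L (coordVec 1)) ≠ 0 := by
    intro h; rw [h] at hD2; norm_num at hD2; exact hpos.ne hD2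
  set X := L (coordVec 0)
  set Y := L (coordVec 1)
  refine ⟨Matrix.of fun i j => if j = 0 then triple n (K (coordVec i)) Y / triple n X Y else
    triple n X (K (coordVec i)) / triple n X Y, fun i => ?_⟩
  simp only [Matrix.of_apply, if_true, one_ne_zero, if_false]
  have hz := hnK (coordVec i)
  set Z := K (coordVec i)
  -- Cramer's rule in the basis X, Y, n: the coefficient of Z along n is proportional to det(Z, X,
  -- Y), which vanishes because Z is orthogonal to n.
  have key : ∀ a : E3, triple n X Y * ⟪Z, a⟫ = triple n Z Y * ⟪X, a⟫ + triple n X Z * ⟪Y, a⟫ := by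
    intro a
    have e : triple n X Y * ⟪Z, a⟫ = triple n Z Y * ⟪X, a⟫ + triple n X Z * ⟪Y, a⟫ +
        triple Z X Y * ⟪n, a⟫ := by
      simp only [triple_apply, inner_eq_coords]; ring
    have h0 := triple_eq_mul_inner hn (hnL _ : ⟪n, X⟫ = 0) (hnL _ : ⟪n, Y⟫ = 0) Z
    rw [e, h0, hz]; ring
  refine ext_inner_right ℝ fun a => ?_
  rw [inner_add_left, real_inner_smul_left, real_inner_smul_left]
  have := key a
  field_simp
  linarith

variable {S : Matrix (Fin 2) (Fin 2) ℝ}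

theorem formOf_eq_neg_mul (hS : ∀ i, K (coordVec i) = S i 0 • L (coordVec 0) + S i 1 • L (coordVec 1)) :
    formOf L K = -(S * gram L) := by
  ext i j
  simp only [formOf, Matrix.of_apply, hS, inner_add_left, real_inner_smul_left, Matrix.neg_apply,
    Matrix.mul_apply, Fin.sum_univ_two, gram]

theorem meanOf_eq_neg_trace (hL : Function.Injective L)
    (hS : ∀ i, K (coordVec i) = S i 0 • L (coordVec 0) + S i 1 • L (coordVec 1)) :
    meanOf L K = -(S 0 0 + S 1 1) := by
  rw [meanOf, formOf_eq_neg_mul hS, Matrix.mul_neg, Matrix.trace_neg, ← Matrix.mul_assoc,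
    Matrix.trace_mul_comm, ← Matrix.mul_assoc, Matrix.mul_nonsing_inv _ (isUnit_gram_det hL),
    Matrix.one_mul, Matrix.trace_fin_two]

theorem normSqOf_eq_trace_sq (hL : Function.Injective L)
    (hS : ∀ i, K (coordVec i) = S i 0 • L (coordVec 0) + S i 1 • L (coordVec 1)) :
    normSqOf L K = (S * S).trace := by
  rw [normSqOf, formOf_eq_neg_mul hS, Matrix.mul_neg, neg_mul_neg]
  have : (gram L)⁻¹ * (S * gram L) * ((gram L)⁻¹ * (S * gram L)) =
      (gram L)⁻¹ * (S * S * gram L) := by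
    simp only [Matrix.mul_assoc]
    rw [← Matrix.mul_assoc (gram L) (gram L)⁻¹, Matrix.mul_nonsing_inv _ (isUnit_gram_det hL),
      Matrix.one_mul]
  rw [this, Matrix.trace_mul_comm, Matrix.mul_assoc, Matrix.mul_nonsing_inv _ (isUnit_gram_det hL),
    Matrix.mul_one]

/-- The sum is the trace of g⁻¹ times the third fundamental form ⟨Nᵢ, Nⱼ⟩ = (S g Sᵀ)ᵢⱼ. Symmetry of
the second fundamental form reads g Sᵀ = S g, which turns the trace into tr S² = |A|². -/
theorem sum_norm_gradOf_sq (hL : Function.Injective L) (hn : ‖n‖ = 1) (hnL : ∀ v, ⟪n, L v⟫ = 0)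
    (hnK : ∀ v, ⟪n, K v⟫ = 0) (hsymm : ⟪K (coordVec 0), L (coordVec 1)⟫ = ⟪K (coordVec 1), L (coordVec 0)⟫) :
    ∑ a : Fin 3, ‖gradOf L ((innerSL ℝ (EuclideanSpace.single a (1 : ℝ))).comp K)‖ ^ 2 =
      normSqOf L K := by
  obtain ⟨S, hS⟩ := exists_weingarten hL hn hnL hnK
  have hform := formOf_eq_neg_mul hS
  have hsym : (S * gram L).transpose = S * gram L := by
    rw [← neg_inj, ← Matrix.transpose_neg, ← hform]
    ext i j
    fin_cases i <;> fin_cases j <;> simp [formOf, hsymm]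
  have h1 : ∑ a : Fin 3, ‖gradOf L ((innerSL ℝ (EuclideanSpace.single a (1 : ℝ))).comp K)‖ ^ 2 =
      ((gram L)⁻¹ * (S * gram L * S.transpose)).trace := by
    have h2 : ∀ i j, (S * gram L * S.transpose) i j = ⟪K (coordVec i), K (coordVec j)⟫ := by
      intro i j
      rw [hS, hS]
      simp only [Matrix.mul_apply, Fin.sum_univ_two, Matrix.transpose_apply, gram, Matrix.of_apply,
        inner_add_left, inner_add_right, real_inner_smul_left, real_inner_smul_right]
      ring
    simp only [← real_inner_self_eq_norm_sq, inner_gradOf_gradOf hL]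
    rw [Matrix.trace_fin_two]
    simp only [Matrix.mul_apply (M := (gram L)⁻¹), h2]
    simp only [Fin.sum_univ_two, Fin.sum_univ_three, ContinuousLinearMap.comp_apply,
      innerSL_apply_apply, inner_eq_coords]
    simp
    ring
  have h3 : gram L * S.transpose = S * gram L := by
    rw [Matrix.transpose_mul] at hsym
    rw [← hsym]; congr 1; ext i j; exact gram_symm L i j
  rw [h1, normSqOf_eq_trace_sq hL hS, Matrix.mul_assoc, h3, ← Matrix.mul_assoc S,
    Matrix.trace_mul_comm, Matrix.mul_assoc, Matrix.mul_nonsing_inv _ (isUnit_gram_det hL),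
    Matrix.mul_one]

/-- The components of `√g ∇⟨N, a⟩` are rotated derivatives. -/
theorem triple_mul_inner_gradOf (hL : Function.Injective L) (hn : ‖n‖ = 1)
    (hnL : ∀ v, ⟪n, L v⟫ = 0) (hnK : ∀ v, ⟪n, K v⟫ = 0)
    (hsymm : ⟪K (coordVec 0), L (coordVec 1)⟫ = ⟪K (coordVec 1), L (coordVec 0)⟫)
    (l : E2 →L[ℝ] ℝ) (a : E3) :
    triple n (L (coordVec 0)) (L (coordVec 1)) * ⟪gradOf L l, gradOf L ((innerSL ℝ a).comp K)⟫ =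
      l (coordVec 0) * (meanOf L K * triple a n (L (coordVec 1)) + triple a n (K (coordVec 1)))
      - l (coordVec 1) * (meanOf L K * triple a n (L (coordVec 0)) + triple a n (K (coordVec 0))) := by
  -- As H = -tr S, one has H Xᵢ + Nᵢ = -(adj S)ᵢⱼ Xⱼ. In an orthonormal frame, rotation by a right
  -- angle conjugates a symmetric 2×2 matrix into its adjugate, so the rotated gradient of ⟨N, a⟩ is
  -- given by these vectors.
  obtain ⟨S, hS⟩ := exists_weingarten hL hn hnL hnK
  have hD2 := triple_normal_sq_eq_det hn hnL
  have hpos := gram_det_pos hL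
  have hD : triple n (L (coordVec 0)) (L (coordVec 1)) ≠ 0 := by
    intro h; rw [h] at hD2; norm_num at hD2; exact hpos.ne hD2
  have h0 := triple_normal_left hn (hnL (coordVec 0)) (hnL (coordVec 1)) a
  have h1 := triple_normal_right hn (hnL (coordVec 0)) (hnL (coordVec 1)) a
  rw [inner_gradOf_gradOf hL, meanOf_eq_neg_trace hL hS]
  simp only [Fin.sum_univ_two, ContinuousLinearMap.comp_apply, innerSL_apply_apply,
    Matrix.inv_def, Ring.inverse_eq_inv', Matrix.smul_apply, Matrix.adjugate_fin_two, ← hD2]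
  have hc := real_inner_comm (L (coordVec 0)) (L (coordVec 1))
  rw [hS, hS] at hsymm ⊢
  simp only [gram, Matrix.of_apply, inner_add_left, real_inner_smul_left, map_add, map_smul,
    smul_eq_mul, Matrix.cons_val', Matrix.cons_val_zero, Matrix.cons_val_one, inner_add_right,
    real_inner_smul_right, Matrix.cons_val_fin_one] at hsymm ⊢
  rw [hc] at hsymm ⊢
  rw [real_inner_comm a, real_inner_comm a] at h0 h1
  generalize triple n (L (coordVec 0)) (L (coordVec 1)) = D at *
  -- The hypotheses `h0` and `h1` control det(a, n, Xᵢ) only after multiplication by D. The extra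
  -- factor D also cancels the D⁻² coming from the inverse of the Gram matrix.
  apply mul_left_cancel₀ hD
  have hDD : D * D * (D ^ 2)⁻¹ = 1 := by field_simp
  generalize (D ^ 2)⁻¹ = R at *
  generalize triple a n (L (coordVec 0)) = p at *
  generalize triple a n (L (coordVec 1)) = q at *
  generalize ⟪a, L (coordVec 0)⟫ = x at *
  generalize ⟪a, L (coordVec 1)⟫ = y at *
  generalize ⟪L (coordVec 0), L (coordVec 0)⟫ = E at *
  generalize ⟪L (coordVec 0), L (coordVec 1)⟫ = F at *
  generalize ⟪L (coordVec 1), L (coordVec 1)⟫ = G at *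
  generalize l (coordVec 0) = l0
  generalize l (coordVec 1) = l1
  have e0 : D * (D * (R * G * (l0 * (S 0 0 * x + S 0 1 * y)) + R * -F * (l0 * (S 1 0 * x + S 1 1 * y)) +
      (R * -F * (l1 * (S 0 0 * x + S 0 1 * y)) + R * E * (l1 * (S 1 0 * x + S 1 1 * y)))))
      = (G * (l0 * (S 0 0 * x + S 0 1 * y)) + -F * (l0 * (S 1 0 * x + S 1 1 * y)) +
      ( -F * (l1 * (S 0 0 * x + S 0 1 * y)) +  E * (l1 * (S 1 0 * x + S 1 1 * y)))) := by
    linear_combination (G * (l0 * (S 0 0 * x + S 0 1 * y)) + -F * (l0 * (S 1 0 * x + S 1 1 * y)) +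
      ( -F * (l1 * (S 0 0 * x + S 0 1 * y)) +  E * (l1 * (S 1 0 * x + S 1 1 * y)))) * hDD
  trans D * (D * (R * G * (l0 * (S 0 0 * x + S 0 1 * y)) + R * -F * (l0 * (S 1 0 * x + S 1 1 * y)) +
      (R * -F * (l1 * (S 0 0 * x + S 0 1 * y)) + R * E * (l1 * (S 1 0 * x + S 1 1 * y)))))
  · ring
  rw [e0]
  linear_combination (-(l0 * S 1 0) + l1 * (S 0 0 - (S 0 0 + S 1 1))) * h0
    + (-l0 * (S 1 1 - (S 0 0 + S 1 1)) + l1 * S 0 1) * h1 + (l0 * y - l1 * x) * hsymm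

/-- The divergence of the rotated derivatives. -/
theorem triple_mul_normSqOf (hL : Function.Injective L) (hn : ‖n‖ = 1)
    (hnL : ∀ v, ⟪n, L v⟫ = 0) (hnK : ∀ v, ⟪n, K v⟫ = 0) (a : E3) :
    triple n (L (coordVec 0)) (L (coordVec 1)) * (normSqOf L K * ⟪a, n⟫) =
      -(meanOf L K * (triple a (K (coordVec 0)) (L (coordVec 1))
        + triple a (L (coordVec 0)) (K (coordVec 1)))
        + 2 * triple a (K (coordVec 0)) (K (coordVec 1))) := by
  -- Here N₀ × X₁ + X₀ × N₁ = (tr S) X₀ × X₁ and N₀ × N₁ = (det S) X₀ × X₁. With H = -tr S the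
  -- identity becomes tr S² = (tr S)² - 2 det S.
  obtain ⟨S, hS⟩ := exists_weingarten hL hn hnL hnK
  have h0 := triple_eq_mul_inner hn (hnL (coordVec 0)) (hnL (coordVec 1)) a
  rw [meanOf_eq_neg_trace hL hS, normSqOf_eq_trace_sq hL hS, hS, hS, Matrix.trace_fin_two]
  have e : ∀ u, triple a u u = 0 := fun u => by simp only [triple_apply]; ring
  simp only [map_add, map_smul, add_apply, smul_apply,
    smul_eq_mul, e, triple_swap a (L (coordVec 1)) (L (coordVec 0)), h0, Matrix.mul_apply,
    Fin.sum_univ_two, real_inner_comm n a]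
  ring

end GaussMap

/-! ### Surfaces in charts -/

section Charts

variable {M : Type*} [TopologicalSpace M] [ChartedSpace (EuclideanHalfSpace 2) M]
  {F : Type*} [NormedAddCommGroup F] [NormedSpace ℝ F]

/-- The differential, in the chart `e`, of a map on the surface. -/
def chartD (f : M → F) (e : OpenPartialHomeomorph M (EuclideanHalfSpace 2)) (y : E2) : E2 →L[ℝ] F :=
  fderivWithin ℝ (f ∘ (e.extend (𝓡∂ 2)).symm) (range (𝓡∂ 2)) y

/-- The differential of the change of charts from `e` to `e'`. -/
def transD (e e' : OpenPartialHomeomorph M (EuclideanHalfSpace 2)) (y : E2) : E2 →L[ℝ] E2 :=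
  fderivWithin ℝ ((𝓡∂ 2).extendCoordChange e e') (range (𝓡∂ 2)) y

theorem target_mem_nhdsWithin {e : OpenPartialHomeomorph M (EuclideanHalfSpace 2)} {y : E2}
    (hy : y ∈ (e.extend (𝓡∂ 2)).target) : (e.extend (𝓡∂ 2)).target ∈ 𝓝[range (𝓡∂ 2)] y := by
  have h := (e.extend (𝓡∂ 2)).map_target hy
  rw [e.extend_source] at h
  have h1 := e.extend_target_mem_nhdsWithin (I := 𝓡∂ 2) h
  rwa [(e.extend (𝓡∂ 2)).right_inv hy] at h1

theorem symm_mem_source {e : OpenPartialHomeomorph M (EuclideanHalfSpace 2)} {y : E2}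
    (hy : y ∈ (e.extend (𝓡∂ 2)).target) : (e.extend (𝓡∂ 2)).symm y ∈ e.source := by
  have h := (e.extend (𝓡∂ 2)).map_target hy
  rwa [e.extend_source] at h

theorem extend_mem_target {e : OpenPartialHomeomorph M (EuclideanHalfSpace 2)} {p : M}
    (hp : p ∈ e.source) : e.extend (𝓡∂ 2) p ∈ (e.extend (𝓡∂ 2)).target :=
  (e.extend (𝓡∂ 2)).map_source (by rwa [e.extend_source])

theorem mem_range_of_mem_target {e : OpenPartialHomeomorph M (EuclideanHalfSpace 2)} {y : E2}
    (hy : y ∈ (e.extend (𝓡∂ 2)).target) : y ∈ range (𝓡∂ 2) :=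
  e.extend_target_subset_range hy

theorem measurableSet_extend_target (e : OpenPartialHomeomorph M (EuclideanHalfSpace 2)) :
    MeasurableSet (e.extend (𝓡∂ 2)).target := by
  rw [e.extend_target]
  exact ((e.open_target.preimage (𝓡∂ 2).continuous_symm).measurableSet).inter
    (𝓡∂ 2).isClosed_range.measurableSet

theorem range_subset_closure_interior : range (𝓡∂ 2) ⊆ closure (interior (range (𝓡∂ 2))) :=
  (𝓡∂ 2).range_subset_closure_interior

variable [IsManifold (𝓡∂ 2) ∞ M] {e e' : OpenPartialHomeomorph M (EuclideanHalfSpace 2)}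

theorem contDiffWithinAt_chart (he : e ∈ atlas (EuclideanHalfSpace 2) M) {f : M → F}
    (hf : ContMDiff (𝓡∂ 2) 𝓘(ℝ, F) ∞ f) {y : E2} (hy : y ∈ (e.extend (𝓡∂ 2)).target) :
    ContDiffWithinAt ℝ ∞ (f ∘ (e.extend (𝓡∂ 2)).symm) (range (𝓡∂ 2)) y := by
  have h := hf.comp_contMDiffOn
    (contMDiffOn_extend_symm (I := 𝓡∂ 2) (n := ∞) (IsManifold.subset_maximalAtlas he))
  rw [← e.extend_target', contMDiffOn_iff_contDiffOn] at h
  exact (h y hy).mono_of_mem_nhdsWithin (target_mem_nhdsWithin hy)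

theorem contDiffWithinAt_chartD (he : e ∈ atlas (EuclideanHalfSpace 2) M) {f : M → F}
    (hf : ContMDiff (𝓡∂ 2) 𝓘(ℝ, F) ∞ f) {y : E2} (hy : y ∈ (e.extend (𝓡∂ 2)).target) :
    ContDiffWithinAt ℝ ∞ (chartD f e) (range (𝓡∂ 2)) y :=
  (contDiffWithinAt_chart he hf hy).fderivWithin_right (𝓡∂ 2).uniqueDiffOn (by norm_num)
    (mem_range_of_mem_target hy)

theorem hasFDerivWithinAt_chart (he : e ∈ atlas (EuclideanHalfSpace 2) M) {f : M → F}
    (hf : ContMDiff (𝓡∂ 2) 𝓘(ℝ, F) ∞ f) {y : E2} (hy : y ∈ (e.extend (𝓡∂ 2)).target) :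
    HasFDerivWithinAt (f ∘ (e.extend (𝓡∂ 2)).symm) (chartD f e y) (range (𝓡∂ 2)) y :=
  ((contDiffWithinAt_chart he hf hy).differentiableWithinAt (by norm_num)).hasFDerivWithinAt

theorem trans_contDiffWithinAt (he : e ∈ atlas (EuclideanHalfSpace 2) M)
    (he' : e' ∈ atlas (EuclideanHalfSpace 2) M) {y : E2}
    (hy : y ∈ ((𝓡∂ 2).extendCoordChange e e').source) :
    ContDiffWithinAt ℝ ∞ ((𝓡∂ 2).extendCoordChange e e') (range (𝓡∂ 2)) y :=
  ModelWithCorners.contDiffWithinAt_extendCoordChange (IsManifold.subset_maximalAtlas he)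
    (IsManifold.subset_maximalAtlas he') hy

theorem hasFDerivWithinAt_trans (he : e ∈ atlas (EuclideanHalfSpace 2) M)
    (he' : e' ∈ atlas (EuclideanHalfSpace 2) M) {y : E2}
    (hy : y ∈ ((𝓡∂ 2).extendCoordChange e e').source) :
    HasFDerivWithinAt ((𝓡∂ 2).extendCoordChange e e') (transD e e' y) (range (𝓡∂ 2)) y :=
  ((trans_contDiffWithinAt he he' hy).differentiableWithinAt (by norm_num)).hasFDerivWithinAt

theorem mem_extendCoordChange_source {y : E2} : y ∈ ((𝓡∂ 2).extendCoordChange e e').source ↔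
    y ∈ (e.extend (𝓡∂ 2)).target ∧ (e.extend (𝓡∂ 2)).symm y ∈ e'.source := by
  rw [ModelWithCorners.extendCoordChange, PartialEquiv.trans_source, PartialEquiv.symm_source,
    e'.extend_source]
  rfl

theorem extendCoordChange_apply (y : E2) : (𝓡∂ 2).extendCoordChange e e' y =
    e'.extend (𝓡∂ 2) ((e.extend (𝓡∂ 2)).symm y) := rfl

theorem extendCoordChange_mem_target {y : E2}
    (hy : y ∈ ((𝓡∂ 2).extendCoordChange e e').source) :
    (𝓡∂ 2).extendCoordChange e e' y ∈ (e'.extend (𝓡∂ 2)).target :=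
  extend_mem_target (mem_extendCoordChange_source.1 hy).2

theorem symm_extendCoordChange {y : E2} (hy : y ∈ ((𝓡∂ 2).extendCoordChange e e').source) :
    (e'.extend (𝓡∂ 2)).symm ((𝓡∂ 2).extendCoordChange e e' y) = (e.extend (𝓡∂ 2)).symm y :=
  (e'.extend (𝓡∂ 2)).left_inv (by rw [e'.extend_source]; exact (mem_extendCoordChange_source.1 hy).2)

theorem mem_extendCoordChange_symm {y : E2} (hy : y ∈ ((𝓡∂ 2).extendCoordChange e e').source) :
    (𝓡∂ 2).extendCoordChange e e' y ∈ ((𝓡∂ 2).extendCoordChange e' e).source := by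
  rw [mem_extendCoordChange_source, symm_extendCoordChange hy]
  exact ⟨extendCoordChange_mem_target hy, symm_mem_source (mem_extendCoordChange_source.1 hy).1⟩

theorem extendCoordChange_extendCoordChange {y : E2}
    (hy : y ∈ ((𝓡∂ 2).extendCoordChange e e').source) :
    (𝓡∂ 2).extendCoordChange e' e ((𝓡∂ 2).extendCoordChange e e' y) = y := by
  rw [extendCoordChange_apply (e := e'), symm_extendCoordChange hy]
  exact (e.extend (𝓡∂ 2)).right_inv (mem_extendCoordChange_source.1 hy).1

theorem chartD_eq_comp_transD (he : e ∈ atlas (EuclideanHalfSpace 2) M)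
    (he' : e' ∈ atlas (EuclideanHalfSpace 2) M) {f : M → F} (hf : ContMDiff (𝓡∂ 2) 𝓘(ℝ, F) ∞ f)
    {y : E2} (hy : y ∈ ((𝓡∂ 2).extendCoordChange e e').source) :
    chartD f e y = (chartD f e' ((𝓡∂ 2).extendCoordChange e e' y)).comp (transD e e' y) := by
  have hyr := mem_range_of_mem_target (mem_extendCoordChange_source.1 hy).1
  have h2 := (hasFDerivWithinAt_chart he' hf (extendCoordChange_mem_target hy)).comp y
    ((hasFDerivWithinAt_trans he he' hy).mono
      (s := ((𝓡∂ 2).extendCoordChange e e').source)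
      (fun z hz => mem_range_of_mem_target (mem_extendCoordChange_source.1 hz).1))
    (fun z hz => mem_range_of_mem_target (extendCoordChange_mem_target hz))
  have hmem := ModelWithCorners.extendCoordChange_source_mem_nhdsWithin (I := 𝓡∂ 2) hy
  have h3 := (h2.congr (f₁ := f ∘ (e.extend (𝓡∂ 2)).symm)
    (fun z hz => by simp only [Function.comp_apply]; rw [symm_extendCoordChange hz])
    (by simp only [Function.comp_apply]; rw [symm_extendCoordChange hy])).mono_of_mem_nhdsWithin hmem
  exact h3.fderivWithin ((𝓡∂ 2).uniqueDiffOn y hyr)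

theorem transD_comp_transD (he : e ∈ atlas (EuclideanHalfSpace 2) M)
    (he' : e' ∈ atlas (EuclideanHalfSpace 2) M) {y : E2}
    (hy : y ∈ ((𝓡∂ 2).extendCoordChange e e').source) :
    (transD e' e ((𝓡∂ 2).extendCoordChange e e' y)).comp (transD e e' y) =
      ContinuousLinearMap.id ℝ E2 := by
  have hyr := mem_range_of_mem_target (mem_extendCoordChange_source.1 hy).1
  have h2 := (hasFDerivWithinAt_trans he' he (mem_extendCoordChange_symm hy)).comp y
    ((hasFDerivWithinAt_trans he he' hy).mono
      (s := ((𝓡∂ 2).extendCoordChange e e').source)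
      (fun z hz => mem_range_of_mem_target (mem_extendCoordChange_source.1 hz).1))
    (fun z hz => mem_range_of_mem_target (extendCoordChange_mem_target hz))
  have hmem := ModelWithCorners.extendCoordChange_source_mem_nhdsWithin (I := 𝓡∂ 2) hy
  have h3 := (h2.congr (f₁ := id) (fun z hz => (extendCoordChange_extendCoordChange hz).symm)
    (extendCoordChange_extendCoordChange hy).symm).mono_of_mem_nhdsWithin hmem
  exact ((𝓡∂ 2).uniqueDiffOn y hyr).eq h3 (hasFDerivWithinAt_id y _)

theorem transD_det_ne_zero (he : e ∈ atlas (EuclideanHalfSpace 2) M)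
    (he' : e' ∈ atlas (EuclideanHalfSpace 2) M) {y : E2}
    (hy : y ∈ ((𝓡∂ 2).extendCoordChange e e').source) : (transD e e' y).det ≠ 0 := by
  intro h
  have h1 := congrArg ContinuousLinearMap.det (transD_comp_transD he he' hy)
  rw [← det_matOf, matOf, ContinuousLinearMap.toLinearMap_comp, LinearMap.toMatrix_comp _
    (EuclideanSpace.basisFun (Fin 2) ℝ).toBasis, Matrix.det_mul] at h1
  change (matOf _).det * (matOf _).det = _ at h1
  rw [det_matOf, det_matOf, h] at h1
  simp [ContinuousLinearMap.det] at h1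

theorem diffAt_eq_chartD {f : M → F} (hf : ContMDiff (𝓡∂ 2) 𝓘(ℝ, F) ∞ f) (p : M) :
    diffAt f p = chartD f (chartAt (EuclideanHalfSpace 2) p) (extChartAt (𝓡∂ 2) p p) :=
  (hf.mdifferentiable (by norm_num) p).mfderiv

/-- The change of charts at `p` from the preferred chart to `e`. -/
def toChart (e : OpenPartialHomeomorph M (EuclideanHalfSpace 2)) (p : M) : E2 →L[ℝ] E2 :=
  transD (chartAt (EuclideanHalfSpace 2) p) e (extChartAt (𝓡∂ 2) p p)

theorem mem_source_preferred {p : M} (hp : p ∈ e.source) :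
    extChartAt (𝓡∂ 2) p p ∈
      ((𝓡∂ 2).extendCoordChange (chartAt (EuclideanHalfSpace 2) p) e).source := by
  refine mem_extendCoordChange_source.2 ⟨mem_extChartAt_target p, ?_⟩
  change (extChartAt (𝓡∂ 2) p).symm _ ∈ _
  rwa [extChartAt_to_inv]

/-- `diffAt` uses the preferred chart at each point, which may jump from point to point. Rewriting
in one fixed chart makes the geometric quantities accessible to calculus; the factor `toChart` drops
out of all invariants. -/
theorem diffAt_eq_comp (he : e ∈ atlas (EuclideanHalfSpace 2) M) {f : M → F}
    (hf : ContMDiff (𝓡∂ 2) 𝓘(ℝ, F) ∞ f) {p : M} (hp : p ∈ e.source) :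
    diffAt f p = (chartD f e (e.extend (𝓡∂ 2) p)).comp (toChart e p) := by
  rw [diffAt_eq_chartD hf,
    chartD_eq_comp_transD (chart_mem_atlas _ p) he hf (mem_source_preferred hp),
    extendCoordChange_apply]
  change (chartD f e (e.extend (𝓡∂ 2) ((extChartAt (𝓡∂ 2) p).symm _))).comp _ = _
  rw [extChartAt_to_inv, toChart]

theorem toChart_det_ne_zero (he : e ∈ atlas (EuclideanHalfSpace 2) M) {p : M} (hp : p ∈ e.source) :
    (toChart e p).det ≠ 0 :=
  transD_det_ne_zero (chart_mem_atlas _ p) he (mem_source_preferred hp)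

end Charts

/-! ### The first-order identities of an immersion and its Gauss map in an arbitrary chart. -/

section Immersion

variable {M : Type*} [TopologicalSpace M] [ChartedSpace (EuclideanHalfSpace 2) M]
  [IsManifold (𝓡∂ 2) ∞ M] {Ω : Set E3} {x N : M → E3}
  {e : OpenPartialHomeomorph M (EuclideanHalfSpace 2)}

theorem chartD_injective (he : e ∈ atlas (EuclideanHalfSpace 2) M) (hx : IsImmersedSurface Ω x N)
    {p : M} (hp : p ∈ e.source) : Function.Injective (chartD x e (e.extend (𝓡∂ 2) p)) := by
  have h := hx.immersion p
  rw [diffAt_eq_comp he hx.smooth hp, ContinuousLinearMap.coe_comp] at h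
  have hs : Function.Surjective (toChart e p) :=
    (LinearMap.equivOfDetNeZero _ (toChart_det_ne_zero he hp)).surjective
  exact h.of_comp_right hs

theorem surfGrad_eq (he : e ∈ atlas (EuclideanHalfSpace 2) M) (hx : IsImmersedSurface Ω x N)
    {f : M → ℝ} (hf : ContMDiff (𝓡∂ 2) 𝓘(ℝ, ℝ) ∞ f) {p : M} (hp : p ∈ e.source) :
    surfGrad x f p = gradOf (chartD x e (e.extend (𝓡∂ 2) p)) (chartD f e (e.extend (𝓡∂ 2) p)) := by
  change gradOf (diffAt x p) (diffAt f p) = _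
  rw [diffAt_eq_comp he hx.smooth hp, diffAt_eq_comp he hf hp,
    gradOf_comp (chartD_injective he hx hp) (toChart_det_ne_zero he hp)]

theorem normSqA_eq (he : e ∈ atlas (EuclideanHalfSpace 2) M) (hx : IsImmersedSurface Ω x N)
    {p : M} (hp : p ∈ e.source) : normSqA x N p =
      normSqOf (chartD x e (e.extend (𝓡∂ 2) p)) (chartD N e (e.extend (𝓡∂ 2) p)) := by
  change normSqOf (diffAt x p) (diffAt N p) = _
  rw [diffAt_eq_comp he hx.smooth hp, diffAt_eq_comp he hx.smooth_normal hp,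
    normSqOf_comp _ _ (toChart_det_ne_zero he hp)]

theorem meanCurvature_eq (he : e ∈ atlas (EuclideanHalfSpace 2) M) (hx : IsImmersedSurface Ω x N)
    {p : M} (hp : p ∈ e.source) : meanCurvature x N p =
      meanOf (chartD x e (e.extend (𝓡∂ 2) p)) (chartD N e (e.extend (𝓡∂ 2) p)) := by
  change meanOf (diffAt x p) (diffAt N p) = _
  rw [diffAt_eq_comp he hx.smooth hp, diffAt_eq_comp he hx.smooth_normal hp,
    meanOf_comp _ _ (toChart_det_ne_zero he hp)]

theorem inner_normal_chartD (he : e ∈ atlas (EuclideanHalfSpace 2) M) (hx : IsImmersedSurface Ω x N)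
    {p : M} (hp : p ∈ e.source) (v : E2) : ⟪N p, chartD x e (e.extend (𝓡∂ 2) p) v⟫ = 0 := by
  have hs : Function.Surjective (toChart e p) :=
    (LinearMap.equivOfDetNeZero _ (toChart_det_ne_zero he hp)).surjective
  obtain ⟨w, rfl⟩ := hs v
  have h := hx.normal p w
  rwa [diffAt_eq_comp he hx.smooth hp] at h

/-! The same facts at a point `y` of the half plane. -/

variable {y : E2}

theorem chartD_injective' (he : e ∈ atlas (EuclideanHalfSpace 2) M) (hx : IsImmersedSurface Ω x N)
    (hy : y ∈ (e.extend (𝓡∂ 2)).target) : Function.Injective (chartD x e y) := by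
  have h := chartD_injective he hx (symm_mem_source hy)
  rwa [(e.extend (𝓡∂ 2)).right_inv hy] at h

theorem inner_normal_chartD' (he : e ∈ atlas (EuclideanHalfSpace 2) M)
    (hx : IsImmersedSurface Ω x N) (hy : y ∈ (e.extend (𝓡∂ 2)).target) (v : E2) :
    ⟪N ((e.extend (𝓡∂ 2)).symm y), chartD x e y v⟫ = 0 := by
  have h := inner_normal_chartD he hx (symm_mem_source hy) v
  rwa [(e.extend (𝓡∂ 2)).right_inv hy] at h

/-- Two functions agreeing on the chart domain have the same derivative. -/
theorem eq_of_hasFDerivWithinAt {F : Type*} [NormedAddCommGroup F] [NormedSpace ℝ F] {f g : E2 → F}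
    {f' g' : E2 →L[ℝ] F} (hy : y ∈ (e.extend (𝓡∂ 2)).target)
    (hf : HasFDerivWithinAt f f' (range (𝓡∂ 2)) y) (hg : HasFDerivWithinAt g g' (range (𝓡∂ 2)) y)
    (h : ∀ z ∈ (e.extend (𝓡∂ 2)).target, f z = g z) : f' = g' := by
  have h1 : HasFDerivWithinAt f g' (range (𝓡∂ 2)) y :=
    hg.congr_of_eventuallyEq (mem_of_superset (target_mem_nhdsWithin hy) h) (h y hy)
  exact ((𝓡∂ 2).uniqueDiffOn y (mem_range_of_mem_target hy)).eq hf h1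

/-- Differentiate ⟨N, N⟩ = 1. -/
theorem inner_normal_chartD_normal (he : e ∈ atlas (EuclideanHalfSpace 2) M)
    (hx : IsImmersedSurface Ω x N) (hy : y ∈ (e.extend (𝓡∂ 2)).target) (v : E2) :
    ⟪N ((e.extend (𝓡∂ 2)).symm y), chartD N e y v⟫ = 0 := by
  have hN := hasFDerivWithinAt_chart he hx.smooth_normal hy
  have h1 := hN.inner ℝ hN
  have h2 := eq_of_hasFDerivWithinAt hy h1 (hasFDerivWithinAt_const (1 : ℝ) y (range (𝓡∂ 2)))
    (fun z _ => by simp [hx.norm_normal])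
  have h3 := congrArg (fun L => L v) h2
  simp only [ContinuousLinearMap.comp_apply, ContinuousLinearMap.prod_apply, fderivInnerCLM_apply,
    Function.comp_apply, zero_apply] at h3
  rw [real_inner_comm _ (chartD N e y v)] at h3
  linarith

theorem hasFDerivWithinAt_chartD {F : Type*} [NormedAddCommGroup F] [NormedSpace ℝ F]
    (he : e ∈ atlas (EuclideanHalfSpace 2) M) {f : M → F} (hf : ContMDiff (𝓡∂ 2) 𝓘(ℝ, F) ∞ f)
    (hy : y ∈ (e.extend (𝓡∂ 2)).target) :
    HasFDerivWithinAt (chartD f e) (fderivWithin ℝ (chartD f e) (range (𝓡∂ 2)) y)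
      (range (𝓡∂ 2)) y :=
  ((contDiffWithinAt_chartD he hf hy).differentiableWithinAt (by norm_num)).hasFDerivWithinAt

theorem fderivWithin_chartD_symm {F : Type*} [NormedAddCommGroup F] [NormedSpace ℝ F]
    (he : e ∈ atlas (EuclideanHalfSpace 2) M) {f : M → F} (hf : ContMDiff (𝓡∂ 2) 𝓘(ℝ, F) ∞ f)
    (hy : y ∈ (e.extend (𝓡∂ 2)).target) (v w : E2) :
    fderivWithin ℝ (chartD f e) (range (𝓡∂ 2)) y v w =
      fderivWithin ℝ (chartD f e) (range (𝓡∂ 2)) y w v := by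
  have hr := mem_range_of_mem_target hy
  -- Symmetry persists at points of the edge because the half plane lies in the closure of its
  -- interior.
  exact (contDiffWithinAt_chart he hf hy).isSymmSndFDerivWithinAt (by simp; norm_cast) (𝓡∂ 2).uniqueDiffOn
    (range_subset_closure_interior hr) hr v w

/-- Differentiating ⟨N, ∂_w x⟩ = 0 along v gives ⟨∂_v N, ∂_w x⟩ = -⟨N, ∂_v ∂_w x⟩, which is
symmetric in v and w. -/
theorem inner_chartD_symm (he : e ∈ atlas (EuclideanHalfSpace 2) M) (hx : IsImmersedSurface Ω x N)
    (hy : y ∈ (e.extend (𝓡∂ 2)).target) (v w : E2) :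
    ⟪chartD N e y v, chartD x e y w⟫ = ⟪chartD N e y w, chartD x e y v⟫ := by
  have hN := hasFDerivWithinAt_chart he hx.smooth_normal hy
  have key : ∀ v w : E2, ⟪chartD N e y v, chartD x e y w⟫ =
      -⟪N ((e.extend (𝓡∂ 2)).symm y), fderivWithin ℝ (chartD x e) (range (𝓡∂ 2)) y v w⟫ := by
    intro v w
    have h1 := hN.inner ℝ ((hasFDerivWithinAt_chartD he hx.smooth hy).clm_apply
      (hasFDerivWithinAt_const w y _))
    have h2 := eq_of_hasFDerivWithinAt hy h1 (hasFDerivWithinAt_const (0 : ℝ) y (range (𝓡∂ 2)))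
      (fun z hz => inner_normal_chartD' he hx hz w)
    have h3 := congrArg (fun L => L v) h2
    simp only [ContinuousLinearMap.comp_apply, ContinuousLinearMap.prod_apply,
      fderivInnerCLM_apply, Function.comp_apply, zero_apply, add_apply, map_zero, zero_add,
      ContinuousLinearMap.flip_apply] at h3
    linarith
  rw [key, key, fderivWithin_chartD_symm he hx.smooth hy]

end Immersion

/-! ### Continuity of the curvature and of gradients on the surface. -/

section Continuity

variable {α : Type*} [TopologicalSpace α] {s : Set α} {a : α}

theorem continuousWithinAt_gram {L : α → E2 →L[ℝ] E3} (hL : ContinuousWithinAt L s a) :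
    ContinuousWithinAt (fun z => gram (L z)) s a := by
  refine continuousWithinAt_pi.2 fun i => continuousWithinAt_pi.2 fun j => ?_
  exact ContinuousWithinAt.inner (𝕜 := ℝ) (hL.clm_apply continuousWithinAt_const) (hL.clm_apply continuousWithinAt_const)

theorem continuousWithinAt_gram_det {L : α → E2 →L[ℝ] E3} (hL : ContinuousWithinAt L s a) :
    ContinuousWithinAt (fun z => (gram (L z)).det) s a :=
  (continuous_id.matrix_det.tendsto (gram (L a))).comp (continuousWithinAt_gram hL)

theorem continuousWithinAt_gram_inv {L : α → E2 →L[ℝ] E3} (hL : ContinuousWithinAt L s a)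
    (hinj : Function.Injective (L a)) : ContinuousWithinAt (fun z => (gram (L z))⁻¹) s a := by
  simp only [Matrix.inv_def, Ring.inverse_eq_inv']
  exact ((continuousWithinAt_gram_det hL).inv₀ (gram_det_pos hinj).ne').smul
    ((continuous_id.matrix_adjugate.tendsto (gram (L a))).comp (continuousWithinAt_gram hL))

theorem continuousWithinAt_formOf {L K : α → E2 →L[ℝ] E3} (hL : ContinuousWithinAt L s a)
    (hK : ContinuousWithinAt K s a) : ContinuousWithinAt (fun z => formOf (L z) (K z)) s a := by
  refine continuousWithinAt_pi.2 fun i => continuousWithinAt_pi.2 fun j => ?_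
  exact (ContinuousWithinAt.inner (𝕜 := ℝ) (hK.clm_apply continuousWithinAt_const)
    (hL.clm_apply continuousWithinAt_const)).neg

theorem continuousWithinAt_normSqOf {L K : α → E2 →L[ℝ] E3} (hL : ContinuousWithinAt L s a)
    (hK : ContinuousWithinAt K s a) (hinj : Function.Injective (L a)) :
    ContinuousWithinAt (fun z => normSqOf (L z) (K z)) s a := by
  have hS : ContinuousWithinAt (fun z => (gram (L z))⁻¹ * formOf (L z) (K z)) s a :=
    (continuousWithinAt_gram_inv hL hinj).mul (continuousWithinAt_formOf hL hK)
  have hT := hS.mul hS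
  have hc : Continuous fun q : Matrix (Fin 2) (Fin 2) ℝ => q.trace := continuous_id.matrix_trace
  exact (hc.tendsto _).comp hT

theorem continuousWithinAt_gradOf {L : α → E2 →L[ℝ] E3} {l : α → E2 →L[ℝ] ℝ}
    (hL : ContinuousWithinAt L s a) (hl : ContinuousWithinAt l s a)
    (hinj : Function.Injective (L a)) : ContinuousWithinAt (fun z => gradOf (L z) (l z)) s a := by
  have hg := continuousWithinAt_gram_inv hL hinj
  refine tendsto_finsetSum _ fun i _ => tendsto_finsetSum _ fun j _ => ?_
  exact ((continuousWithinAt_pi.1 (continuousWithinAt_pi.1 hg i) j).mul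
    (hl.clm_apply continuousWithinAt_const)).smul (hL.clm_apply continuousWithinAt_const)

variable {M : Type*} [TopologicalSpace M] [ChartedSpace (EuclideanHalfSpace 2) M]
  [IsManifold (𝓡∂ 2) ∞ M] {Ω : Set E3} {x N : M → E3}

theorem continuousAt_chartD {F : Type*} [NormedAddCommGroup F] [NormedSpace ℝ F]
    {e : OpenPartialHomeomorph M (EuclideanHalfSpace 2)}
    (he : e ∈ atlas (EuclideanHalfSpace 2) M) {f : M → F} (hf : ContMDiff (𝓡∂ 2) 𝓘(ℝ, F) ∞ f)
    {p : M} (hp : p ∈ e.source) : ContinuousAt (fun q => chartD f e (e.extend (𝓡∂ 2) q)) p := by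
  have h := (contDiffWithinAt_chartD he hf (extend_mem_target hp)).continuousWithinAt
  have h2 : Tendsto (e.extend (𝓡∂ 2)) (𝓝 p) (𝓝[range (𝓡∂ 2)] (e.extend (𝓡∂ 2) p)) :=
    tendsto_nhdsWithin_iff.2 ⟨e.continuousAt_extend hp, Eventually.of_forall fun q => ⟨e q, rfl⟩⟩
  exact h.tendsto.comp h2

theorem continuous_normSqA (hx : IsImmersedSurface Ω x N) : Continuous (normSqA x N) := by
  refine continuous_iff_continuousAt.2 fun p => ?_
  have he := chart_mem_atlas (EuclideanHalfSpace 2) p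
  have hp := mem_chart_source (EuclideanHalfSpace 2) p
  set e := chartAt (EuclideanHalfSpace 2) p
  have h := continuousWithinAt_normSqOf
    (continuousWithinAt_univ _ _ |>.2 (continuousAt_chartD he hx.smooth hp))
    (continuousWithinAt_univ _ _ |>.2 (continuousAt_chartD he hx.smooth_normal hp))
    (chartD_injective he hx hp)
  rw [continuousWithinAt_univ] at h
  exact h.congr (mem_of_superset (e.open_source.mem_nhds hp) fun q hq => (normSqA_eq he hx hq).symm)

theorem continuous_surfGrad (hx : IsImmersedSurface Ω x N) {f : M → ℝ}
    (hf : ContMDiff (𝓡∂ 2) 𝓘(ℝ, ℝ) ∞ f) : Continuous (surfGrad x f) := by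
  refine continuous_iff_continuousAt.2 fun p => ?_
  have he := chart_mem_atlas (EuclideanHalfSpace 2) p
  have hp := mem_chart_source (EuclideanHalfSpace 2) p
  set e := chartAt (EuclideanHalfSpace 2) p
  have h := continuousWithinAt_gradOf
    (continuousWithinAt_univ _ _ |>.2 (continuousAt_chartD he hx.smooth hp))
    (continuousWithinAt_univ _ _ |>.2 (continuousAt_chartD he hf hp))
    (chartD_injective he hx hp)
  rw [continuousWithinAt_univ] at h
  exact h.congr (mem_of_superset (e.open_source.mem_nhds hp)
    fun q hq => (surfGrad_eq he hx hf hq).symm)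

/-- `∑ |∇⟨N, eₐ⟩|² = |A|²`. -/
theorem sum_norm_surfGrad_sq (hx : IsImmersedSurface Ω x N) (p : M) :
    ∑ a : Fin 3, ‖surfGrad x (fun q => ⟪EuclideanSpace.single a (1 : ℝ), N q⟫) p‖ ^ 2 =
      normSqA x N p := by
  have he := chart_mem_atlas (EuclideanHalfSpace 2) p
  have hp := mem_chart_source (EuclideanHalfSpace 2) p
  set e := chartAt (EuclideanHalfSpace 2) p
  have hy := extend_mem_target hp
  have hinv : (e.extend (𝓡∂ 2)).symm (e.extend (𝓡∂ 2) p) = p :=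
    (e.extend (𝓡∂ 2)).left_inv (by rwa [e.extend_source])
  rw [normSqA_eq he hx hp, ← sum_norm_gradOf_sq (chartD_injective he hx hp) (hx.norm_normal p)
    (inner_normal_chartD he hx hp) (fun v => by
      have := inner_normal_chartD_normal he hx hy v
      rwa [hinv] at this) (inner_chartD_symm he hx hy _ _)]
  refine Finset.sum_congr rfl fun a _ => ?_
  rw [surfGrad_eq he hx _ hp]
  · congr 2
    congr 1
    have h := ((innerSL ℝ (EuclideanSpace.single a (1 : ℝ) : E3)).hasFDerivAt).comp_hasFDerivWithinAt _
        (hasFDerivWithinAt_chart he hx.smooth_normal hy)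
    exact h.fderivWithin ((𝓡∂ 2).uniqueDiffOn _ (mem_range_of_mem_target hy))
  · exact (innerSL ℝ (EuclideanSpace.single a (1 : ℝ) : E3)).contDiff.comp_contMDiff hx.smooth_normal

end Continuity

/-! ### Area and length measures -/

/-- A supremum of measures which are compatible on the sets `src e`. -/
theorem iSup_measure_apply_of_compatible {M ι : Type*} [MeasurableSpace M] (A : Set ι)
    (μ : ι → Measure M) (src : ι → Set M) (hsrc : ∀ e ∈ A, MeasurableSet (src e))
    (hcomp : ∀ e ∈ A, ∀ e' ∈ A, ∀ s, MeasurableSet s → s ⊆ src e → μ e' s ≤ μ e s)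
    {e : ι} (he : e ∈ A) {s : Set M} (hs : MeasurableSet s) (hse : s ⊆ src e) :
    (⨆ e ∈ A, μ e) s = μ e s := by
  apply le_antisymm
  · have hle : (⨆ e ∈ A, μ e) ≤ μ e + (⨆ e ∈ A, μ e).restrict (src e)ᶜ := by
      refine iSup₂_le fun e' he' => Measure.le_iff.2 fun t ht => ?_
      rw [← measure_inter_add_sdiff t (hsrc e he), Measure.add_apply, Measure.restrict_apply ht]
      refine add_le_add ?_ ?_
      · exact (hcomp e he e' he' _ (ht.inter (hsrc e he)) inter_subset_right).trans
          (measure_mono inter_subset_left)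
      · exact (le_iSup₂ (f := fun e _ => μ e) e' he') _
    refine (hle s).trans ?_
    rw [Measure.add_apply, Measure.restrict_apply hs,
      show s ∩ (src e)ᶜ = ∅ from by rw [← sdiff_eq]; exact sdiff_eq_empty.2 hse]
    simp
  · exact (le_iSup₂ (f := fun e _ => μ e) e he) s

theorem mem_range_iff {y : E2} : y ∈ range (𝓡∂ 2) ↔ 0 ≤ y 0 := by
  rw [range_modelWithCornersEuclideanHalfSpace]; rfl

theorem mem_interior_range_iff {y : E2} : y ∈ interior (range (𝓡∂ 2)) ↔ 0 < y 0 := by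
  rw [interior_range_modelWithCornersEuclideanHalfSpace]; rfl

theorem edgePt_apply_zero (s : ℝ) : edgePt s 0 = 0 := by simp [edgePt]

theorem edgePt_apply_one (s : ℝ) : edgePt s 1 = s := by simp [edgePt]

theorem edgePt_mem_range (s : ℝ) : edgePt s ∈ range (𝓡∂ 2) :=
  mem_range_iff.2 (edgePt_apply_zero s).ge

theorem eq_edgePt {y : E2} (h : y 0 = 0) : y = edgePt (y 1) := by
  ext i; fin_cases i <;> simp [edgePt, h]

theorem edgePt_eq (s : ℝ) : edgePt s = s • coordVec 1 := by
  ext i; fin_cases i <;> simp [edgePt, coordVec]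

theorem hasDerivAt_edgePt (s : ℝ) : HasDerivAt edgePt (coordVec 1) s := by
  have h := (hasDerivAt_id s).smul_const (coordVec 1)
  rw [one_smul] at h
  exact h.congr_of_eventuallyEq (Eventually.of_forall edgePt_eq)

theorem continuous_edgePt : Continuous edgePt :=
  continuous_iff_continuousAt.2 fun s => (hasDerivAt_edgePt s).continuousAt

/-! ### Boundary points in charts, chart independence and finiteness of the area and length
measures. -/

section Measures

variable {M : Type*} [TopologicalSpace M] [ChartedSpace (EuclideanHalfSpace 2) M]
  [IsManifold (𝓡∂ 2) ∞ M] {e e' : OpenPartialHomeomorph M (EuclideanHalfSpace 2)}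

theorem mem_boundary_iff (he : e ∈ atlas (EuclideanHalfSpace 2) M) {p : M} (hp : p ∈ e.source) :
    p ∈ (𝓡∂ 2).boundary M ↔ e.extend (𝓡∂ 2) p 0 = 0 := by
  have hy := extend_mem_target hp
  change (𝓡∂ 2).IsBoundaryPoint p ↔ _
  rw [ModelWithCorners.isBoundaryPoint_iff_of_mem_atlas (n := ∞) (by norm_num) he hp, ← not_iff_not,
    ← mem_interior_iff_notMem_frontier hy]
  have hint : interior (e.extend (𝓡∂ 2)).target =
      (𝓡∂ 2).symm ⁻¹' e.target ∩ interior (range (𝓡∂ 2)) := by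
    rw [e.extend_target, interior_inter,
      (e.open_target.preimage (𝓡∂ 2).continuous_symm).interior_eq]
  have hr := mem_range_iff.1 (mem_range_of_mem_target hy)
  rw [hint, mem_inter_iff, mem_interior_range_iff]
  rw [e.extend_target] at hy
  exact ⟨fun h => h.2.ne', fun h => ⟨hy.1, lt_of_le_of_ne hr (Ne.symm h)⟩⟩

theorem symm_edgePt_mem_boundary (he : e ∈ atlas (EuclideanHalfSpace 2) M) {s : ℝ}
    (hs : edgePt s ∈ (e.extend (𝓡∂ 2)).target) :
    (e.extend (𝓡∂ 2)).symm (edgePt s) ∈ (𝓡∂ 2).boundary M := by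
  rw [mem_boundary_iff he (symm_mem_source hs), (e.extend (𝓡∂ 2)).right_inv hs, edgePt_apply_zero]

theorem isOpen_edge (e : OpenPartialHomeomorph M (EuclideanHalfSpace 2)) :
    IsOpen {s | edgePt s ∈ (e.extend (𝓡∂ 2)).target} := by
  have : {s | edgePt s ∈ (e.extend (𝓡∂ 2)).target} =
      edgePt ⁻¹' ((𝓡∂ 2).symm ⁻¹' e.target) := by
    ext s
    rw [mem_ofPred_eq, e.extend_target]
    exact ⟨fun h => h.1, fun h => ⟨h, edgePt_mem_range s⟩⟩
  rw [this]
  exact (e.open_target.preimage (𝓡∂ 2).continuous_symm).preimage continuous_edgePt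

theorem isOpen_edge_trans (e e' : OpenPartialHomeomorph M (EuclideanHalfSpace 2)) :
    IsOpen {s | edgePt s ∈ ((𝓡∂ 2).extendCoordChange e e').source} := by
  have : {s | edgePt s ∈ ((𝓡∂ 2).extendCoordChange e e').source} =
      edgePt ⁻¹' ((𝓡∂ 2).symm ⁻¹' (e.symm ≫ₕ e').source) := by
    ext s
    rw [mem_ofPred_eq, ModelWithCorners.extendCoordChange_source, (𝓡∂ 2).image_eq]
    exact ⟨fun h => h.1, fun h => ⟨h, edgePt_mem_range s⟩⟩
  rw [this]
  exact ((e.symm ≫ₕ e').open_source.preimage (𝓡∂ 2).continuous_symm).preimage continuous_edgePt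

variable [MeasurableSpace M] [BorelSpace M] {Ω : Set E3} {x N : M → E3}

theorem measurableSet_target_inter (e : OpenPartialHomeomorph M (EuclideanHalfSpace 2)) {A : Set M}
    (hA : MeasurableSet A) :
    MeasurableSet ((e.extend (𝓡∂ 2)).target ∩ (e.extend (𝓡∂ 2)).symm ⁻¹' A) := by
  have h : Measurable ((e.extend (𝓡∂ 2)).target.domRestrict (e.extend (𝓡∂ 2)).symm) :=
    (continuousOn_iff_continuous_domRestrict.1 e.continuousOn_extend_symm).measurable
  have h2 := (measurableSet_extend_target e).subtype_image (h hA)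
  rwa [show (Subtype.val '' ((e.extend (𝓡∂ 2)).target.domRestrict (e.extend (𝓡∂ 2)).symm ⁻¹' A)) =
    (e.extend (𝓡∂ 2)).target ∩ (e.extend (𝓡∂ 2)).symm ⁻¹' A from ?_] at h2
  ext y
  constructor
  · rintro ⟨⟨z, hz⟩, h, rfl⟩
    exact ⟨hz, h⟩
  · rintro ⟨h1, h2⟩
    exact ⟨⟨y, h1⟩, h2, rfl⟩

theorem continuousOn_edge (e : OpenPartialHomeomorph M (EuclideanHalfSpace 2)) :
    ContinuousOn (fun s => (e.extend (𝓡∂ 2)).symm (edgePt s))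
      {s | edgePt s ∈ (e.extend (𝓡∂ 2)).target} :=
  e.continuousOn_extend_symm.comp continuous_edgePt.continuousOn fun _ h => h

theorem measurableSet_edge_inter (e : OpenPartialHomeomorph M (EuclideanHalfSpace 2)) {A : Set M}
    (hA : MeasurableSet A) :
    MeasurableSet {s | edgePt s ∈ (e.extend (𝓡∂ 2)).target ∧
      (e.extend (𝓡∂ 2)).symm (edgePt s) ∈ A} :=
  continuous_edgePt.measurable (measurableSet_target_inter e hA)

theorem aemeasurable_symm (x : M → E3) (e : OpenPartialHomeomorph M (EuclideanHalfSpace 2)) :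
    AEMeasurable (e.extend (𝓡∂ 2)).symm
      (((volume : Measure E2).restrict (e.extend (𝓡∂ 2)).target).withDensity
        fun y => ENNReal.ofReal √(gram (chartDeriv x e y)).det) :=
  ((e.continuousOn_extend_symm).aemeasurable (measurableSet_extend_target e)).mono_ac
    (withDensity_absolutelyContinuous _ _)

theorem aemeasurable_edge (x : M → E3) (e : OpenPartialHomeomorph M (EuclideanHalfSpace 2)) :
    AEMeasurable (fun s => (e.extend (𝓡∂ 2)).symm (edgePt s))
      (((volume : Measure ℝ).restrict {s | edgePt s ∈ (e.extend (𝓡∂ 2)).target}).withDensity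
        fun s => ENNReal.ofReal ‖chartDeriv x e (edgePt s) (coordVec 1)‖) :=
  ((continuousOn_edge e).aemeasurable (isOpen_edge e).measurableSet).mono_ac
    (withDensity_absolutelyContinuous _ _)

theorem chartArea_apply (x : M → E3) (e : OpenPartialHomeomorph M (EuclideanHalfSpace 2))
    {A : Set M} (hA : MeasurableSet A) : chartArea x e A =
      ∫⁻ y in (e.extend (𝓡∂ 2)).target ∩ (e.extend (𝓡∂ 2)).symm ⁻¹' A,
        ENNReal.ofReal √(gram (chartD x e y)).det := by
  rw [chartArea, Measure.map_apply_of_aemeasurable (aemeasurable_symm x e) hA, withDensity_apply',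
    Measure.restrict_restrict' (measurableSet_extend_target e), inter_comm]
  rfl

theorem chartLength_apply (x : M → E3) (e : OpenPartialHomeomorph M (EuclideanHalfSpace 2))
    {A : Set M} (hA : MeasurableSet A) : chartLength x e A =
      ∫⁻ s in {s | edgePt s ∈ (e.extend (𝓡∂ 2)).target ∧ (e.extend (𝓡∂ 2)).symm (edgePt s) ∈ A},
        ENNReal.ofReal ‖chartD x e (edgePt s) (coordVec 1)‖ := by
  rw [chartLength, Measure.map_apply_of_aemeasurable (aemeasurable_edge x e) hA, withDensity_apply',
    Measure.restrict_restrict' (isOpen_edge e).measurableSet, inter_comm]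
  rfl

/-- This is the change of variables formula for the transition map, whose Jacobian is absorbed by
the area density. An inequality suffices for `iSup_measure_apply_of_compatible`. -/
theorem chartArea_le_of_subset (he : e ∈ atlas (EuclideanHalfSpace 2) M)
    (he' : e' ∈ atlas (EuclideanHalfSpace 2) M) (hx : ContMDiff (𝓡∂ 2) 𝓘(ℝ, E3) ∞ x)
    {A : Set M} (hA : MeasurableSet A) (hAe : A ⊆ e.source) : chartArea x e' A ≤ chartArea x e A := by
  rw [chartArea_apply x e hA, chartArea_apply x e' hA]
  set S := (e'.extend (𝓡∂ 2)).target ∩ (e'.extend (𝓡∂ 2)).symm ⁻¹' A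
  have hS : ∀ y ∈ S, y ∈ ((𝓡∂ 2).extendCoordChange e' e).source := fun y hy =>
    mem_extendCoordChange_source.2 ⟨hy.1, hAe hy.2⟩
  have h1 : ∫⁻ y in S, ENNReal.ofReal √(gram (chartD x e' y)).det =
      ∫⁻ y in S, ENNReal.ofReal |(transD e' e y).det| *
        ENNReal.ofReal √(gram (chartD x e ((𝓡∂ 2).extendCoordChange e' e y))).det := by
    refine setLIntegral_congr_fun (measurableSet_target_inter e' hA) fun y hy => ?_
    rw [chartD_eq_comp_transD he' he hx (hS y hy), sqrt_gram_det_comp,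
      ENNReal.ofReal_mul (abs_nonneg _)]
  rw [h1, ← lintegral_image_eq_lintegral_abs_det_fderiv_mul volume
    (measurableSet_target_inter e' hA)
    (fun y hy => (hasFDerivWithinAt_trans he' he (hS y hy)).mono
      fun z hz => mem_range_of_mem_target hz.1)
    (fun y hy z hz h => by
      rw [← extendCoordChange_extendCoordChange (hS y hy), h,
        extendCoordChange_extendCoordChange (hS z hz)])
    (fun y => ENNReal.ofReal √(gram (chartD x e y)).det)]
  refine lintegral_mono_set ?_
  rintro _ ⟨y, hy, rfl⟩
  refine ⟨extendCoordChange_mem_target (hS y hy), ?_⟩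
  rw [mem_preimage, symm_extendCoordChange (hS y hy)]
  exact hy.2

/-- Being a boundary point does not depend on the chart, so transition maps carry the edge into the
edge. -/
theorem extendCoordChange_edgePt (he : e ∈ atlas (EuclideanHalfSpace 2) M)
    (he' : e' ∈ atlas (EuclideanHalfSpace 2) M) {s : ℝ}
    (hs : edgePt s ∈ ((𝓡∂ 2).extendCoordChange e' e).source) :
    (𝓡∂ 2).extendCoordChange e' e (edgePt s) =
      edgePt ((𝓡∂ 2).extendCoordChange e' e (edgePt s) 1) := by
  have h := mem_extendCoordChange_source.1 hs
  exact eq_edgePt ((mem_boundary_iff he h.2).1 (symm_edgePt_mem_boundary he' h.1))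

theorem hasDerivAt_extendCoordChange_edgePt (he : e ∈ atlas (EuclideanHalfSpace 2) M)
    (he' : e' ∈ atlas (EuclideanHalfSpace 2) M) {s : ℝ}
    (hs : edgePt s ∈ ((𝓡∂ 2).extendCoordChange e' e).source) :
    HasDerivAt (fun s => (𝓡∂ 2).extendCoordChange e' e (edgePt s))
      (transD e' e (edgePt s) (coordVec 1)) s := by
  have h := (hasFDerivWithinAt_trans he' he hs).comp_hasDerivWithinAt s
    ((hasDerivAt_edgePt s).hasDerivWithinAt (s := univ)) (fun z _ => edgePt_mem_range z)
  exact hasDerivWithinAt_univ.1 h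

/-- The first coordinate of the transition map vanishes along the edge near `s`, hence so does its
derivative in the edge direction. -/
theorem transD_edgePt (he : e ∈ atlas (EuclideanHalfSpace 2) M)
    (he' : e' ∈ atlas (EuclideanHalfSpace 2) M) {s : ℝ}
    (hs : edgePt s ∈ ((𝓡∂ 2).extendCoordChange e' e).source) :
    transD e' e (edgePt s) (coordVec 1) = transD e' e (edgePt s) (coordVec 1) 1 • coordVec 1 := by
  rw [← edgePt_eq]
  refine eq_edgePt ?_
  have h := hasDerivAt_extendCoordChange_edgePt he he' hs
  have h0 := ((EuclideanSpace.proj (0 : Fin 2) : E2 →L[ℝ] ℝ).hasFDerivAt).comp_hasDerivAt s h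
  have h1 : HasDerivAt (fun s => (EuclideanSpace.proj (0 : Fin 2) : E2 →L[ℝ] ℝ)
      ((𝓡∂ 2).extendCoordChange e' e (edgePt s))) 0 s := by
    refine (hasDerivAt_const s (0 : ℝ)).congr_of_eventuallyEq ?_
    filter_upwards [(isOpen_edge_trans e' e).mem_nhds hs] with z hz
    change ((𝓡∂ 2).extendCoordChange e' e (edgePt z)) 0 = 0
    rw [extendCoordChange_edgePt he he' hz, edgePt_apply_zero]
  exact h0.unique h1

/-- One-dimensional analogue of `chartArea_le_of_subset`: on the edge the transition is a map σ of
the line, and the chain rule gives |∂ₛx| = |σ'| times the length density of `e` at σ(s). -/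
theorem chartLength_le_of_subset (he : e ∈ atlas (EuclideanHalfSpace 2) M)
    (he' : e' ∈ atlas (EuclideanHalfSpace 2) M) (hx : ContMDiff (𝓡∂ 2) 𝓘(ℝ, E3) ∞ x)
    {A : Set M} (hA : MeasurableSet A) (hAe : A ⊆ e.source) :
    chartLength x e' A ≤ chartLength x e A := by
  rw [chartLength_apply x e hA, chartLength_apply x e' hA]
  have hmeas := measurableSet_edge_inter e' hA
  set S := {s | edgePt s ∈ (e'.extend (𝓡∂ 2)).target ∧ (e'.extend (𝓡∂ 2)).symm (edgePt s) ∈ A}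
  have hS : ∀ s ∈ S, edgePt s ∈ ((𝓡∂ 2).extendCoordChange e' e).source := fun y hy =>
    mem_extendCoordChange_source.2 ⟨hy.1, hAe hy.2⟩
  set σ : ℝ → ℝ := fun s => (𝓡∂ 2).extendCoordChange e' e (edgePt s) 1 with hσ
  have h1 : ∫⁻ s in S, ENNReal.ofReal ‖chartD x e' (edgePt s) (coordVec 1)‖ =
      ∫⁻ s in S, ENNReal.ofReal |transD e' e (edgePt s) (coordVec 1) 1| *
        ENNReal.ofReal ‖chartD x e (edgePt (σ s)) (coordVec 1)‖ := by
    refine setLIntegral_congr_fun hmeas fun s hs => ?_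
    have h2 : chartD x e' (edgePt s) (coordVec 1) =
        transD e' e (edgePt s) (coordVec 1) 1 • chartD x e (edgePt (σ s)) (coordVec 1) := by
      rw [chartD_eq_comp_transD he' he hx (hS s hs), ContinuousLinearMap.comp_apply, ← map_smul,
        ← transD_edgePt he he' (hS s hs)]
      exact congrArg (fun y => chartD x e y (transD e' e (edgePt s) (coordVec 1)))
        (extendCoordChange_edgePt he he' (hS s hs))
    rw [h2, norm_smul, ENNReal.ofReal_mul (norm_nonneg _), Real.norm_eq_abs]
  have hderiv : ∀ s ∈ S, HasDerivWithinAt σ (transD e' e (edgePt s) (coordVec 1) 1) S s :=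
    fun s hs => (((EuclideanSpace.proj (1 : Fin 2) : E2 →L[ℝ] ℝ).hasFDerivAt).comp_hasDerivAt s
      (hasDerivAt_extendCoordChange_edgePt he he' (hS s hs))).hasDerivWithinAt
  rw [h1, ← lintegral_image_eq_lintegral_abs_deriv_mul (f := σ) hmeas hderiv
    (fun s hs t ht h => by
      have h2 : edgePt s = edgePt t := by
        rw [← extendCoordChange_extendCoordChange (hS s hs),
          extendCoordChange_edgePt he he' (hS s hs)]
        change (𝓡∂ 2).extendCoordChange e e' (edgePt (σ s)) = _
        rw [h, hσ, ← extendCoordChange_edgePt he he' (hS t ht),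
          extendCoordChange_extendCoordChange (hS t ht)]
      rw [← edgePt_apply_one s, h2, edgePt_apply_one])
    (fun s => ENNReal.ofReal ‖chartD x e (edgePt s) (coordVec 1)‖)]
  refine lintegral_mono_set ?_
  rintro _ ⟨s, hs, rfl⟩
  rw [mem_ofPred_eq, hσ, ← extendCoordChange_edgePt he he' (hS s hs), symm_extendCoordChange (hS s hs)]
  exact ⟨extendCoordChange_mem_target (hS s hs), hs.2⟩

theorem area_apply_of_subset (he : e ∈ atlas (EuclideanHalfSpace 2) M)
    (hx : ContMDiff (𝓡∂ 2) 𝓘(ℝ, E3) ∞ x) {A : Set M} (hA : MeasurableSet A)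
    (hAe : A ⊆ e.source) : area x A = chartArea x e A :=
  iSup_measure_apply_of_compatible _ _ (fun e => e.source)
    (fun e _ => e.open_source.measurableSet)
    (fun _ he _ he' _ hs hse => chartArea_le_of_subset he he' hx hs hse) he hA hAe

theorem bdryLength_apply_of_subset (he : e ∈ atlas (EuclideanHalfSpace 2) M)
    (hx : ContMDiff (𝓡∂ 2) 𝓘(ℝ, E3) ∞ x) {A : Set M} (hA : MeasurableSet A)
    (hAe : A ⊆ e.source) : bdryLength x A = chartLength x e A :=
  iSup_measure_apply_of_compatible _ _ (fun e => e.source)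
    (fun e _ => e.open_source.measurableSet)
    (fun _ he _ he' _ hs hse => chartLength_le_of_subset he he' hx hs hse) he hA hAe

theorem area_restrict_source (he : e ∈ atlas (EuclideanHalfSpace 2) M)
    (hx : ContMDiff (𝓡∂ 2) 𝓘(ℝ, E3) ∞ x) : (area x).restrict e.source = chartArea x e := by
  ext A hA
  rw [Measure.restrict_apply hA, area_apply_of_subset he hx (hA.inter e.open_source.measurableSet)
    inter_subset_right, chartArea_apply x e (hA.inter e.open_source.measurableSet),
    chartArea_apply x e hA]
  congr 2
  ext y
  exact ⟨fun h => ⟨h.1, h.2.1⟩, fun h => ⟨h.1, h.2, symm_mem_source h.1⟩⟩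

theorem chartLength_le_bdryLength (he : e ∈ atlas (EuclideanHalfSpace 2) M) (x : M → E3) :
    chartLength x e ≤ bdryLength x := by
  exact le_iSup₂ (f := fun e (_ : e ∈ atlas (EuclideanHalfSpace 2) M) => chartLength x e) e he

theorem bdryLength_compl_boundary (x : M → E3) : bdryLength x ((𝓡∂ 2).boundary M)ᶜ = 0 := by
  have hm : MeasurableSet ((𝓡∂ 2).boundary M) :=
    (ModelWithCorners.isClosed_boundary (I := 𝓡∂ 2) (n := ∞) (by norm_num)).measurableSet
  -- Each chart measure is carried by the boundary, so the supremum is dominated by its own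
  -- restriction to the boundary.
  have hle : bdryLength x ≤ (bdryLength x).restrict ((𝓡∂ 2).boundary M) := by
    refine iSup₂_le fun e he => Measure.le_iff.2 fun t ht => ?_
    rw [Measure.restrict_apply ht]
    refine le_trans ?_ (chartLength_le_bdryLength he x _)
    rw [← measure_inter_add_sdiff t hm, chartLength_apply x e (ht.diff hm)]
    have : {s | edgePt s ∈ (e.extend (𝓡∂ 2)).target ∧
        (e.extend (𝓡∂ 2)).symm (edgePt s) ∈ t \ (𝓡∂ 2).boundary M} = ∅ := by
      refine eq_empty_of_forall_notMem fun s hs => ?_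
      exact hs.2.2 (symm_edgePt_mem_boundary he hs.1)
    rw [this]
    simp
  have h := hle ((𝓡∂ 2).boundary M)ᶜ
  rw [Measure.restrict_apply hm.compl, compl_inter_self, measure_empty] at h
  exact le_antisymm h zero_le

theorem ae_mem_boundary (x : M → E3) : ∀ᵐ p ∂(bdryLength x), p ∈ (𝓡∂ 2).boundary M :=
  bdryLength_compl_boundary x

theorem continuousOn_area_density (he : e ∈ atlas (EuclideanHalfSpace 2) M)
    (hx : ContMDiff (𝓡∂ 2) 𝓘(ℝ, E3) ∞ x) :
    ContinuousOn (fun y => √(gram (chartD x e y)).det) (e.extend (𝓡∂ 2)).target := fun _ hy =>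
  (Real.continuous_sqrt.tendsto _).comp (continuousWithinAt_gram_det
    ((contDiffWithinAt_chartD he hx hy).continuousWithinAt.mono e.extend_target_subset_range))

theorem continuousOn_length_density (he : e ∈ atlas (EuclideanHalfSpace 2) M)
    (hx : ContMDiff (𝓡∂ 2) 𝓘(ℝ, E3) ∞ x) :
    ContinuousOn (fun y => ‖chartD x e y (coordVec 1)‖) (e.extend (𝓡∂ 2)).target := fun _ hy =>
  (((contDiffWithinAt_chartD he hx hy).continuousWithinAt.mono
    e.extend_target_subset_range).clm_apply continuousWithinAt_const).norm

/-- A function continuous on the chart domain is bounded near each point. -/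
theorem exists_ball_bound {d : E2 → ℝ} {p : M} (hp : p ∈ e.source)
    (hd : ContinuousOn d (e.extend (𝓡∂ 2)).target) :
    ∃ r > 0, ∃ C, ∀ y ∈ (e.extend (𝓡∂ 2)).target, y ∈ Metric.ball (e.extend (𝓡∂ 2) p) r →
      d y ≤ C := by
  have h := (hd _ (extend_mem_target hp)).eventually (Iio_mem_nhds (lt_add_one (d _)))
  obtain ⟨r, hr, hb⟩ := Metric.mem_nhdsWithin_iff.1 h
  exact ⟨r, hr, d (e.extend (𝓡∂ 2) p) + 1, fun y hy hyr => (hb ⟨hyr, hy⟩ : _ < _).le⟩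

theorem isFiniteMeasure_area [CompactSpace M] (hx : ContMDiff (𝓡∂ 2) 𝓘(ℝ, E3) ∞ x) :
    IsFiniteMeasure (area x) := by
  have : IsLocallyFiniteMeasure (area x) := by
    refine ⟨fun p => ?_⟩
    have he := chart_mem_atlas (EuclideanHalfSpace 2) p
    have hp := mem_chart_source (EuclideanHalfSpace 2) p
    set e := chartAt (EuclideanHalfSpace 2) p
    obtain ⟨r, hr, C, hC⟩ := exists_ball_bound hp (continuousOn_area_density he hx)
    have ho := e.isOpen_extend_preimage (I := 𝓡∂ 2) (s := Metric.ball (e.extend (𝓡∂ 2) p) r)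
      Metric.isOpen_ball
    refine ⟨_, ho.mem_nhds ⟨hp, Metric.mem_ball_self hr⟩, ?_⟩
    rw [area_apply_of_subset he hx ho.measurableSet inter_subset_left,
      chartArea_apply x e ho.measurableSet]
    have hb : ∀ y ∈ (e.extend (𝓡∂ 2)).target ∩ (e.extend (𝓡∂ 2)).symm ⁻¹'
        (e.source ∩ e.extend (𝓡∂ 2) ⁻¹' Metric.ball (e.extend (𝓡∂ 2) p) r),
        y ∈ Metric.ball (e.extend (𝓡∂ 2) p) r := fun y hy => by
      have := hy.2.2
      rwa [mem_preimage, (e.extend (𝓡∂ 2)).right_inv hy.1] at this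
    calc _ ≤ ∫⁻ _ in (e.extend (𝓡∂ 2)).target ∩ (e.extend (𝓡∂ 2)).symm ⁻¹'
        (e.source ∩ e.extend (𝓡∂ 2) ⁻¹' Metric.ball (e.extend (𝓡∂ 2) p) r), ENNReal.ofReal C :=
          setLIntegral_mono' (measurableSet_target_inter e ho.measurableSet)
            fun y hy => ENNReal.ofReal_le_ofReal (hC y hy.1 (hb y hy))
      _ ≤ ∫⁻ _ in Metric.ball (e.extend (𝓡∂ 2) p) r, ENNReal.ofReal C := lintegral_mono_set hb
      _ < ⊤ := by
        rw [setLIntegral_const]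
        exact ENNReal.mul_lt_top ENNReal.ofReal_lt_top measure_ball_lt_top
  exact CompactSpace.isFiniteMeasure

theorem isFiniteMeasure_bdryLength [CompactSpace M] (hx : ContMDiff (𝓡∂ 2) 𝓘(ℝ, E3) ∞ x) :
    IsFiniteMeasure (bdryLength x) := by
  have : IsLocallyFiniteMeasure (bdryLength x) := by
    refine ⟨fun p => ?_⟩
    have he := chart_mem_atlas (EuclideanHalfSpace 2) p
    have hp := mem_chart_source (EuclideanHalfSpace 2) p
    set e := chartAt (EuclideanHalfSpace 2) p
    obtain ⟨r, hr, C, hC⟩ := exists_ball_bound hp (continuousOn_length_density he hx)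
    have ho := e.isOpen_extend_preimage (I := 𝓡∂ 2) (s := Metric.ball (e.extend (𝓡∂ 2) p) r)
      Metric.isOpen_ball
    refine ⟨_, ho.mem_nhds ⟨hp, Metric.mem_ball_self hr⟩, ?_⟩
    rw [bdryLength_apply_of_subset he hx ho.measurableSet inter_subset_left,
      chartLength_apply x e ho.measurableSet]
    have hb : ∀ s ∈ {s | edgePt s ∈ (e.extend (𝓡∂ 2)).target ∧ (e.extend (𝓡∂ 2)).symm (edgePt s) ∈
        (e.source ∩ e.extend (𝓡∂ 2) ⁻¹' Metric.ball (e.extend (𝓡∂ 2) p) r)},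
        edgePt s ∈ Metric.ball (e.extend (𝓡∂ 2) p) r := fun y hy => by
      have := hy.2.2
      rwa [mem_preimage, (e.extend (𝓡∂ 2)).right_inv hy.1] at this
    calc _ ≤ ∫⁻ _ in {s | edgePt s ∈ (e.extend (𝓡∂ 2)).target ∧ (e.extend (𝓡∂ 2)).symm (edgePt s) ∈
        (e.source ∩ e.extend (𝓡∂ 2) ⁻¹' Metric.ball (e.extend (𝓡∂ 2) p) r)}, ENNReal.ofReal C :=
          setLIntegral_mono' (measurableSet_edge_inter e ho.measurableSet)
            fun y hy => ENNReal.ofReal_le_ofReal (hC _ hy.1 (hb y hy))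
      _ ≤ ∫⁻ _ in Metric.ball (e.extend (𝓡∂ 2) p 1) r, ENNReal.ofReal C := by
        refine lintegral_mono_set fun s hs => ?_
        have h := hb s hs
        rw [Metric.mem_ball, dist_eq_norm] at h ⊢
        have h2 := PiLp.norm_apply_le (edgePt s - e.extend (𝓡∂ 2) p) 1
        rw [PiLp.sub_apply, edgePt_apply_one] at h2
        exact h2.trans_lt h
      _ < ⊤ := by
        rw [setLIntegral_const]
        exact ENNReal.mul_lt_top ENNReal.ofReal_lt_top measure_ball_lt_top
  exact CompactSpace.isFiniteMeasure

/-- In a chart around a boundary point the edge is a nonempty open set of parameters, on which the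
length density is positive because x is an immersion. -/
theorem bdryLength_ne_zero (hx : IsImmersedSurface Ω x N) : bdryLength x ≠ 0 := by
  intro h0
  obtain ⟨p, hpb⟩ := hx.boundary_nonempty
  have he := chart_mem_atlas (EuclideanHalfSpace 2) p
  have hp := mem_chart_source (EuclideanHalfSpace 2) p
  set e := chartAt (EuclideanHalfSpace 2) p
  have h1 : chartLength x e univ = 0 :=
    le_antisymm ((chartLength_le_bdryLength he x univ).trans (by rw [h0]; simp)) zero_le
  rw [chartLength_apply x e MeasurableSet.univ] at h1
  simp only [mem_univ, and_true] at h1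
  have hc : ContinuousOn (fun s => ENNReal.ofReal ‖chartD x e (edgePt s) (coordVec 1)‖)
      {s | edgePt s ∈ (e.extend (𝓡∂ 2)).target} :=
    ENNReal.continuous_ofReal.comp_continuousOn ((continuousOn_length_density he hx.smooth).comp
      continuous_edgePt.continuousOn fun _ h => h)
  rw [lintegral_eq_zero_iff' (hc.aemeasurable (isOpen_edge e).measurableSet)] at h1
  have h2 : ∀ᵐ s ∂(volume.restrict {s | edgePt s ∈ (e.extend (𝓡∂ 2)).target}), False := by
    filter_upwards [h1, ae_restrict_mem (isOpen_edge e).measurableSet] with s hs hmem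
    simp only [Pi.zero_apply, ENNReal.ofReal_eq_zero] at hs
    have h3 := norm_le_zero_iff.1 hs
    exact coordVec_ne_zero 1 (chartD_injective' he hx hmem (by rw [h3, map_zero]))
  have h4 : volume {s | edgePt s ∈ (e.extend (𝓡∂ 2)).target} = 0 := by
    rw [eventually_false_iff_eq_bot, ae_eq_bot, Measure.restrict_eq_zero] at h2
    exact h2
  refine ((isOpen_edge e).measure_pos volume ⟨e.extend (𝓡∂ 2) p 1, ?_⟩).ne' h4
  rw [mem_ofPred_eq, ← eq_edgePt ((mem_boundary_iff he hp).1 hpb)]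
  exact extend_mem_target hp

theorem integral_area_eq (he : e ∈ atlas (EuclideanHalfSpace 2) M)
    (hx : ContMDiff (𝓡∂ 2) 𝓘(ℝ, E3) ∞ x) {f : M → ℝ} (hf : Continuous f)
    (hsupp : ∀ p, p ∉ e.source → f p = 0) :
    ∫ p, f p ∂(area x) = ∫ y in (e.extend (𝓡∂ 2)).target,
      √(gram (chartD x e y)).det * f ((e.extend (𝓡∂ 2)).symm y) := by
  rw [← setIntegral_eq_integral_of_forall_compl_eq_zero (s := e.source) hsupp,
    area_restrict_source he hx, chartArea, integral_map (aemeasurable_symm x e)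
      hf.aestronglyMeasurable, integral_withDensity_eq_integral_toReal_smul₀]
  · refine integral_congr_ae (Eventually.of_forall fun y => ?_)
    simp only [smul_eq_mul]
    rw [ENNReal.toReal_ofReal (Real.sqrt_nonneg _)]
    rfl
  · exact ((continuousOn_area_density he hx).aemeasurable
      (measurableSet_extend_target e)).ennreal_ofReal
  · exact Eventually.of_forall fun _ => ENNReal.ofReal_lt_top

/-- For f ≥ 0 the comparison `chartLength x e ≤ bdryLength x` is enough, since edge integrals only
have to be bounded from above. -/
theorem integral_edge_le [CompactSpace M] (he : e ∈ atlas (EuclideanHalfSpace 2) M)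
    (hx : ContMDiff (𝓡∂ 2) 𝓘(ℝ, E3) ∞ x) {f : M → ℝ} (hf : Continuous f) (hf0 : ∀ p, 0 ≤ f p) :
    IntegrableOn (fun s => ‖chartD x e (edgePt s) (coordVec 1)‖ *
        f ((e.extend (𝓡∂ 2)).symm (edgePt s))) {s | edgePt s ∈ (e.extend (𝓡∂ 2)).target} ∧
    ∫ s in {s | edgePt s ∈ (e.extend (𝓡∂ 2)).target},
      ‖chartD x e (edgePt s) (coordVec 1)‖ * f ((e.extend (𝓡∂ 2)).symm (edgePt s)) ≤
    ∫ p, f p ∂(bdryLength x) := by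
  have := isFiniteMeasure_bdryLength hx
  have hle := chartLength_le_bdryLength he x
  have hi : Integrable f (bdryLength x) := by
    obtain ⟨C, hC⟩ := isCompact_univ.exists_bound_of_continuousOn hf.continuousOn
    exact Integrable.of_bound hf.aestronglyMeasurable C (Eventually.of_forall fun p => hC p trivial)
  have hae : AEMeasurable (fun s => ENNReal.ofReal ‖chartDeriv x e (edgePt s) (coordVec 1)‖)
      (volume.restrict {s | edgePt s ∈ (e.extend (𝓡∂ 2)).target}) :=
    (((continuousOn_length_density he hx).comp continuous_edgePt.continuousOn
      fun _ h => h).aemeasurable (isOpen_edge e).measurableSet).ennreal_ofReal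
  have heq : (fun s => ‖chartD x e (edgePt s) (coordVec 1)‖ *
      f ((e.extend (𝓡∂ 2)).symm (edgePt s))) = fun s =>
      (ENNReal.ofReal ‖chartDeriv x e (edgePt s) (coordVec 1)‖).toReal •
        f ((e.extend (𝓡∂ 2)).symm (edgePt s)) := by
    funext s
    rw [ENNReal.toReal_ofReal (norm_nonneg _), smul_eq_mul]
    rfl
  constructor
  · have h := hi.mono_measure hle
    rw [chartLength, integrable_map_measure hf.aestronglyMeasurable (aemeasurable_edge x e),
      integrable_withDensity_iff_integrable_smul₀' hae
        (Eventually.of_forall fun _ => ENNReal.ofReal_lt_top)] at h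
    rw [heq]
    exact h
  · refine le_trans (le_of_eq ?_) (integral_mono_measure hle (Eventually.of_forall hf0) hi)
    rw [chartLength, integral_map (aemeasurable_edge x e) hf.aestronglyMeasurable,
      integral_withDensity_eq_integral_toReal_smul₀ hae
        (Eventually.of_forall fun _ => ENNReal.ofReal_lt_top), heq]

end Measures

/-! ### The divergence theorem in the half plane -/

/-- The plane as a product. -/
def planeEquiv : E2 ≃L[ℝ] ℝ × ℝ :=
  (EuclideanSpace.equiv (Fin 2) ℝ).trans (ContinuousLinearEquiv.finTwoArrow ℝ ℝ)

theorem planeEquiv_apply (y : E2) : planeEquiv y = (y 0, y 1) := rfl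

theorem planeEquiv_symm_zero (q : ℝ × ℝ) : planeEquiv.symm q 0 = q.1 :=
  congrArg Prod.fst (planeEquiv.apply_symm_apply q)

theorem planeEquiv_symm_one (q : ℝ × ℝ) : planeEquiv.symm q 1 = q.2 :=
  congrArg Prod.snd (planeEquiv.apply_symm_apply q)

theorem planeEquiv_symm_edge (s : ℝ) : planeEquiv.symm (0, s) = edgePt s := by
  rw [eq_edgePt (planeEquiv_symm_zero (0, s)), planeEquiv_symm_one]

theorem planeEquiv_symm_left : planeEquiv.symm (1, 0) = coordVec 0 := by
  rw [ContinuousLinearEquiv.symm_apply_eq, planeEquiv_apply]; simp [coordVec]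

theorem planeEquiv_symm_right : planeEquiv.symm (0, 1) = coordVec 1 := by
  rw [ContinuousLinearEquiv.symm_apply_eq, planeEquiv_apply]; simp [coordVec]

theorem measurePreserving_planeEquiv : MeasurePreserving planeEquiv :=
  (volume_preserving_finTwoArrow ℝ).comp (EuclideanSpace.volume_preserving_symm_measurableEquiv_toLp (Fin 2))

theorem integral_divergence_halfPlane {V W d : E2 → ℝ} {V' W' : E2 → E2 →L[ℝ] ℝ} {R : ℝ}
    (hV : ContinuousOn V (range (𝓡∂ 2))) (hW : ContinuousOn W (range (𝓡∂ 2)))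
    (hd : ContinuousOn d (range (𝓡∂ 2)))
    (hV' : ∀ y ∈ interior (range (𝓡∂ 2)), HasFDerivAt V (V' y) y)
    (hW' : ∀ y ∈ interior (range (𝓡∂ 2)), HasFDerivAt W (W' y) y)
    (hdiv : ∀ y ∈ interior (range (𝓡∂ 2)), V' y (coordVec 0) + W' y (coordVec 1) = d y)
    (hR : 0 < R)
    (hsupp : ∀ y ∈ range (𝓡∂ 2), R ≤ ‖y‖ → V y = 0 ∧ W y = 0 ∧ d y = 0) :
    ∫ y in range (𝓡∂ 2), d y = -∫ s, V (edgePt s) := by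
  have hmaps : ∀ q : ℝ × ℝ, 0 ≤ q.1 → planeEquiv.symm q ∈ range (𝓡∂ 2) := fun q hq => by
    rw [mem_range_iff, planeEquiv_symm_zero]; exact hq
  have hmapsI : ∀ q : ℝ × ℝ, 0 < q.1 → planeEquiv.symm q ∈ interior (range (𝓡∂ 2)) := fun q hq => by
    rw [mem_interior_range_iff, planeEquiv_symm_zero]; exact hq
  have hnorm1 : ∀ q : ℝ × ℝ, |q.1| ≤ ‖planeEquiv.symm q‖ := fun q => by
    have := PiLp.norm_apply_le (planeEquiv.symm q) 0
    rwa [planeEquiv_symm_zero, Real.norm_eq_abs] at this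
  have hnorm2 : ∀ q : ℝ × ℝ, |q.2| ≤ ‖planeEquiv.symm q‖ := fun q => by
    have := PiLp.norm_apply_le (planeEquiv.symm q) 1
    rwa [planeEquiv_symm_one, Real.norm_eq_abs] at this
  have hbox : ∀ q ∈ Icc ((0, -R) : ℝ × ℝ) (R, R), 0 ≤ q.1 := fun q hq => hq.1.1
  have hcont : ∀ g : E2 → ℝ, ContinuousOn g (range (𝓡∂ 2)) →
      ContinuousOn (fun q => g (planeEquiv.symm q)) (Icc ((0, -R) : ℝ × ℝ) (R, R)) := fun g hg =>
    hg.comp planeEquiv.symm.continuous.continuousOn fun q hq => hmaps q (hbox q hq)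
  have hderiv : ∀ (g : E2 → ℝ) (g' : E2 → E2 →L[ℝ] ℝ),
      (∀ y ∈ interior (range (𝓡∂ 2)), HasFDerivAt g (g' y) y) →
      ∀ q ∈ Ioo (0 : ℝ) R ×ˢ Ioo (-R) R \ ∅, HasFDerivAt (fun q => g (planeEquiv.symm q))
        ((g' (planeEquiv.symm q)).comp (planeEquiv.symm : ℝ × ℝ →L[ℝ] E2)) q := fun g g' hg q hq =>
    (hg _ (hmapsI q hq.1.1.1)).comp q planeEquiv.symm.hasFDerivAt
  have hae : ∀ᵐ q ∂(volume.restrict (Icc ((0, -R) : ℝ × ℝ) (R, R))),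
      V' (planeEquiv.symm q) (planeEquiv.symm (1, 0)) + W' (planeEquiv.symm q) (planeEquiv.symm (0, 1))
        = d (planeEquiv.symm q) := by
    -- The divergence identity is assumed only in the open half plane. The edge q.1 = 0 is a null
    -- set of the box, so this is sufficient.
    have hnull : ∀ᵐ q : ℝ × ℝ, q.1 ≠ 0 := by
      have h0 : ∀ᵐ s : ℝ, s ≠ 0 := by simp [ae_iff]
      exact (Measure.quasiMeasurePreserving_fst (μ := (volume : Measure ℝ))
        (ν := (volume : Measure ℝ))).ae h0
    filter_upwards [ae_restrict_mem measurableSet_Icc, ae_restrict_of_ae hnull] with q hq hq0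
    rw [planeEquiv_symm_left, planeEquiv_symm_right]
    exact hdiv _ (hmapsI q (lt_of_le_of_ne (hbox q hq) (Ne.symm hq0)))
  have hint : IntegrableOn (fun q => d (planeEquiv.symm q)) (Icc ((0, -R) : ℝ × ℝ) (R, R)) :=
    (hcont d hd).integrableOn_compact isCompact_Icc
  have key := integral_divergence_prod_Icc_of_hasFDerivAt_off_countable_of_le
    (fun q => V (planeEquiv.symm q)) (fun q => W (planeEquiv.symm q))
    (fun q => (V' (planeEquiv.symm q)).comp (planeEquiv.symm : ℝ × ℝ →L[ℝ] E2))
    (fun q => (W' (planeEquiv.symm q)).comp (planeEquiv.symm : ℝ × ℝ →L[ℝ] E2))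
    (0, -R) (R, R) ⟨hR.le, by simp; linarith⟩ ∅ countable_empty (hcont V hV) (hcont W hW)
    (hderiv V V' hV') (hderiv W W' hW') (hint.congr (by
      filter_upwards [hae] with q hq
      exact hq.symm))
  have hleft : ∫ y in range (𝓡∂ 2), d y =
      ∫ q in Icc ((0, -R) : ℝ × ℝ) (R, R), d (planeEquiv.symm q) := by
    have h1 := measurePreserving_planeEquiv.setIntegral_preimage_emb
      planeEquiv.toHomeomorph.measurableEmbedding (fun q => d (planeEquiv.symm q))
      (Icc ((0, -R) : ℝ × ℝ) (R, R))
    rw [← h1]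
    simp only [ContinuousLinearEquiv.symm_apply_apply]
    refine setIntegral_eq_of_subset_of_forall_sdiff_eq_zero
      (𝓡∂ 2).isClosed_range.measurableSet ?_ ?_
    · exact fun y hy => mem_range_iff.2 (hbox _ hy)
    · rintro y ⟨hy, hn⟩
      refine (hsupp y hy ?_).2.2
      by_contra hlt
      push Not at hlt
      have h0 := PiLp.norm_apply_le y 0
      have h2 := PiLp.norm_apply_le y 1
      rw [Real.norm_eq_abs] at h0 h2
      have hr := mem_range_iff.1 hy
      have h3 := abs_le.1 (h0.trans hlt.le)
      have h4 := abs_le.1 (h2.trans hlt.le)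
      exact hn ⟨⟨hr, h4.1⟩, ⟨h3.2, h4.2⟩⟩
  rw [hleft, ← integral_congr_ae hae]
  refine key.trans ?_
  -- Three sides of the box [0, R] × [-R, R] lie where the norm is at least R, so only the side on
  -- the edge contributes. Its outward normal is -e₀, which produces the minus sign.
  have hz1 : ∀ t ∈ uIcc 0 R, W (planeEquiv.symm (t, R)) = 0 := fun t ht => by
    rw [uIcc_of_le hR.le] at ht
    refine (hsupp _ (hmaps _ ht.1) ?_).2.1
    exact (le_abs_self R).trans (hnorm2 (t, R))
  have hz2 : ∀ t ∈ uIcc 0 R, W (planeEquiv.symm (t, -R)) = 0 := fun t ht => by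
    rw [uIcc_of_le hR.le] at ht
    refine (hsupp _ (hmaps _ ht.1) ?_).2.1
    have := hnorm2 (t, -R)
    rw [abs_neg] at this
    exact (le_abs_self R).trans this
  have hz3 : ∀ t ∈ uIcc (-R) R, V (planeEquiv.symm (R, t)) = 0 := fun t _ =>
    (hsupp _ (hmaps _ hR.le) ((le_abs_self R).trans (hnorm1 (R, t)))).1
  simp only
  rw [intervalIntegral.integral_congr hz1, intervalIntegral.integral_congr hz2,
    intervalIntegral.integral_congr hz3]
  simp only [intervalIntegral.integral_zero, planeEquiv_symm_edge]
  rw [intervalIntegral.integral_eq_integral_of_support_subset]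
  · ring
  · intro s hs
    by_contra hn
    refine hs (hsupp _ (edgePt_mem_range s) ?_).1
    have h2 := PiLp.norm_apply_le (edgePt s) 1
    rw [edgePt_apply_one, Real.norm_eq_abs] at h2
    refine le_trans ?_ h2
    by_contra hlt
    push Not at hlt
    exact hn ⟨(abs_lt.1 hlt).1, (abs_lt.1 hlt).2.le⟩

/-! ### The Jacobi equation for the components of the normal -/

section Local

variable {M : Type*} [TopologicalSpace M] [ChartedSpace (EuclideanHalfSpace 2) M]
  [IsManifold (𝓡∂ 2) ∞ M] {e : OpenPartialHomeomorph M (EuclideanHalfSpace 2)}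
  {Ω : Set E3} {x N : M → E3}

/-- The integrand `⟨∇f, ∇⟨N, a⟩⟩ - |A|² f ⟨N, a⟩`. -/
def jacobiForm (x N : M → E3) (a : E3) (f : M → ℝ) (p : M) : ℝ :=
  ⟪surfGrad x f p, surfGrad x (fun q => ⟪a, N q⟫) p⟫ - normSqA x N p * (f p * ⟪a, N p⟫)

/-- The rotated derivative of `N` corrected by the mean curvature, in a chart. -/
def flux (x N : M → E3) (e : OpenPartialHomeomorph M (EuclideanHalfSpace 2)) (H : ℝ) (a : E3)
    (i : Fin 2) (y : E2) : ℝ :=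
  H * triple a (N ((e.extend (𝓡∂ 2)).symm y)) (chartD x e y (coordVec i)) +
    triple a (N ((e.extend (𝓡∂ 2)).symm y)) (chartD N e y (coordVec i))

/-- The oriented area density. -/
def orientedDensity (x N : M → E3) (e : OpenPartialHomeomorph M (EuclideanHalfSpace 2)) (y : E2) :
    ℝ :=
  triple (N ((e.extend (𝓡∂ 2)).symm y)) (chartD x e y (coordVec 0)) (chartD x e y (coordVec 1))

theorem contMDiff_inner_normal (hx : IsImmersedSurface Ω x N) (a : E3) :
    ContMDiff (𝓡∂ 2) 𝓘(ℝ, ℝ) ∞ (fun q => ⟪a, N q⟫) :=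
  (innerSL ℝ a).contDiff.comp_contMDiff hx.smooth_normal

theorem chartD_inner_normal (he : e ∈ atlas (EuclideanHalfSpace 2) M) (hx : IsImmersedSurface Ω x N)
    (a : E3) {y : E2} (hy : y ∈ (e.extend (𝓡∂ 2)).target) :
    chartD (fun q => ⟪a, N q⟫) e y = (innerSL ℝ a).comp (chartD N e y) := by
  have h := ((innerSL ℝ a).hasFDerivAt).comp_hasFDerivWithinAt _
    (hasFDerivWithinAt_chart he hx.smooth_normal hy)
  exact h.fderivWithin ((𝓡∂ 2).uniqueDiffOn _ (mem_range_of_mem_target hy))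

theorem continuous_jacobiForm (hx : IsImmersedSurface Ω x N) (a : E3) {f : M → ℝ}
    (hf : ContMDiff (𝓡∂ 2) 𝓘(ℝ, ℝ) ∞ f) : Continuous (jacobiForm x N a f) :=
  ((continuous_surfGrad hx hf).inner (continuous_surfGrad hx (contMDiff_inner_normal hx a))).sub
    ((continuous_normSqA hx).mul (hf.continuous.mul (contMDiff_inner_normal hx a).continuous))

/-- The last bracket is ∂₀P₁ - ∂₁P₀ for the flux P, so the right-hand side is the divergence of (f
P₁, -f P₀). This is where the mean curvature is replaced by the constant `H`. -/
theorem orientedDensity_mul_jacobiForm (he : e ∈ atlas (EuclideanHalfSpace 2) M)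
    (hx : IsImmersedSurface Ω x N) {H : ℝ} (hH : ∀ p, meanCurvature x N p = H) (a : E3) {f : M → ℝ}
    (hf : ContMDiff (𝓡∂ 2) 𝓘(ℝ, ℝ) ∞ f) {y : E2} (hy : y ∈ (e.extend (𝓡∂ 2)).target) :
    orientedDensity x N e y * jacobiForm x N a f ((e.extend (𝓡∂ 2)).symm y) =
      chartD f e y (coordVec 0) * flux x N e H a 1 y
      - chartD f e y (coordVec 1) * flux x N e H a 0 y
      + f ((e.extend (𝓡∂ 2)).symm y) *
        (H * (triple a (chartD N e y (coordVec 0)) (chartD x e y (coordVec 1))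
          + triple a (chartD x e y (coordVec 0)) (chartD N e y (coordVec 1)))
          + 2 * triple a (chartD N e y (coordVec 0)) (chartD N e y (coordVec 1))) := by
  have hp := symm_mem_source hy
  have hinv := (e.extend (𝓡∂ 2)).right_inv hy
  have hinj := chartD_injective' he hx hy
  have hn := hx.norm_normal ((e.extend (𝓡∂ 2)).symm y)
  have hnL := inner_normal_chartD' he hx hy
  have hnK := inner_normal_chartD_normal he hx hy
  have h1 := triple_mul_inner_gradOf hinj hn hnL hnK (inner_chartD_symm he hx hy _ _)
    (chartD f e y) a
  have h2 := triple_mul_normSqOf hinj hn hnL hnK a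
  have hHy : meanOf (chartD x e y) (chartD N e y) = H := by
    rw [← hH ((e.extend (𝓡∂ 2)).symm y), meanCurvature_eq he hx hp, hinv]
  rw [hHy] at h1 h2
  rw [jacobiForm, surfGrad_eq he hx hf hp, surfGrad_eq he hx (contMDiff_inner_normal hx a) hp,
    normSqA_eq he hx hp, hinv, chartD_inner_normal he hx a hy]
  simp only [flux, orientedDensity]
  linear_combination h1 - f ((e.extend (𝓡∂ 2)).symm y) * h2

theorem continuousWithinAt_flux (he : e ∈ atlas (EuclideanHalfSpace 2) M)
    (hx : IsImmersedSurface Ω x N) (H : ℝ) (a : E3) (i : Fin 2) {y : E2}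
    (hy : y ∈ (e.extend (𝓡∂ 2)).target) :
    ContinuousWithinAt (flux x N e H a i) (range (𝓡∂ 2)) y := by
  have hN := (contDiffWithinAt_chart he hx.smooth_normal hy).continuousWithinAt
  have hX := (contDiffWithinAt_chartD he hx.smooth hy).continuousWithinAt
  have hK := (contDiffWithinAt_chartD he hx.smooth_normal hy).continuousWithinAt
  have ht : ContinuousWithinAt (fun z => triple a (N ((e.extend (𝓡∂ 2)).symm z)))
      (range (𝓡∂ 2)) y := ((triple a).continuous.tendsto _).comp hN
  exact (continuousWithinAt_const.mul (ht.clm_apply (hX.clm_apply continuousWithinAt_const))).add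
    (ht.clm_apply (hK.clm_apply continuousWithinAt_const))

theorem continuousWithinAt_orientedDensity (he : e ∈ atlas (EuclideanHalfSpace 2) M)
    (hx : IsImmersedSurface Ω x N) {y : E2} (hy : y ∈ (e.extend (𝓡∂ 2)).target) :
    ContinuousWithinAt (orientedDensity x N e) (range (𝓡∂ 2)) y := by
  have hN := (contDiffWithinAt_chart he hx.smooth_normal hy).continuousWithinAt
  have hX := (contDiffWithinAt_chartD he hx.smooth hy).continuousWithinAt
  have h0 := hX.clm_apply (continuousWithinAt_const (b := coordVec 0))
  have h1 := hX.clm_apply (continuousWithinAt_const (b := coordVec 1))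
  -- `triple` is bundled as a bilinear map in its last two arguments only. Here the first argument
  -- varies as well, so continuity is checked in coordinates.
  have hc : ∀ {g : E2 → E3} (i : Fin 3), ContinuousWithinAt g (range (𝓡∂ 2)) y →
      ContinuousWithinAt (fun z => g z i) (range (𝓡∂ 2)) y := fun i hg =>
    ((EuclideanSpace.proj i : E3 →L[ℝ] ℝ).continuous.tendsto _).comp hg
  exact (((hc 0 hN).mul (((hc 1 h0).mul (hc 2 h1)).sub ((hc 2 h0).mul (hc 1 h1)))).add
    ((hc 1 hN).mul (((hc 2 h0).mul (hc 0 h1)).sub ((hc 0 h0).mul (hc 2 h1))))).add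
    ((hc 2 hN).mul (((hc 0 h0).mul (hc 1 h1)).sub ((hc 1 h0).mul (hc 0 h1))))

/-- The product rule, with H constant. The terms with second derivatives of x and N are kept
separate because they cancel in ∂₀P₁ - ∂₁P₀. -/
theorem exists_hasFDerivWithinAt_flux (he : e ∈ atlas (EuclideanHalfSpace 2) M)
    (hx : IsImmersedSurface Ω x N) (H : ℝ) (a : E3) (i : Fin 2) {y : E2}
    (hy : y ∈ (e.extend (𝓡∂ 2)).target) :
    ∃ P' : E2 →L[ℝ] ℝ, HasFDerivWithinAt (flux x N e H a i) P' (range (𝓡∂ 2)) y ∧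
      ∀ v, P' v = H * (triple a (N ((e.extend (𝓡∂ 2)).symm y))
          (fderivWithin ℝ (chartD x e) (range (𝓡∂ 2)) y v (coordVec i))
          + triple a (chartD N e y v) (chartD x e y (coordVec i)))
        + (triple a (N ((e.extend (𝓡∂ 2)).symm y))
          (fderivWithin ℝ (chartD N e) (range (𝓡∂ 2)) y v (coordVec i))
          + triple a (chartD N e y v) (chartD N e y (coordVec i))) := by
  have hN := hasFDerivWithinAt_chart he hx.smooth_normal hy
  have hX := (hasFDerivWithinAt_chartD he hx.smooth hy).clm_apply
    (hasFDerivWithinAt_const (coordVec i) y (range (𝓡∂ 2)))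
  have hK := (hasFDerivWithinAt_chartD he hx.smooth_normal hy).clm_apply
    (hasFDerivWithinAt_const (coordVec i) y (range (𝓡∂ 2)))
  have h1 := ((triple a).hasFDerivWithinAt_of_bilinear hN hX).const_mul H
  have h2 := (triple a).hasFDerivWithinAt_of_bilinear hN hK
  refine ⟨_, h1.add h2, fun v => ?_⟩
  simp [mul_add]

variable {K : Set M}

/-- Points outside the chart image are far from the image of a compact subset of the domain. -/
theorem eventually_symm_notMem (hK : IsCompact K) (hKe : K ⊆ e.source) {y : E2}
    (hy : y ∉ (e.extend (𝓡∂ 2)).target) :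
    ∀ᶠ z in 𝓝 y, z ∈ (e.extend (𝓡∂ 2)).target → (e.extend (𝓡∂ 2)).symm z ∉ K := by
  have hc : IsCompact (e.extend (𝓡∂ 2) '' K) :=
    hK.image_of_continuousOn (e.continuousOn_extend.mono (by rwa [e.extend_source]))
  have hn : y ∉ e.extend (𝓡∂ 2) '' K := by
    rintro ⟨p, hp, rfl⟩
    exact hy (extend_mem_target (hKe hp))
  filter_upwards [hc.isClosed.isOpen_compl.mem_nhds hn] with z hz hzt hzK
  exact hz ⟨_, hzK, (e.extend (𝓡∂ 2)).right_inv hzt⟩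

/-- Extension by zero outside the chart image preserves continuity. -/
theorem continuousOn_indicator (hK : IsCompact K) (hKe : K ⊆ e.source) {h : E2 → ℝ}
    (hc : ∀ y ∈ (e.extend (𝓡∂ 2)).target, ContinuousWithinAt h (range (𝓡∂ 2)) y)
    (h0 : ∀ y ∈ (e.extend (𝓡∂ 2)).target, (e.extend (𝓡∂ 2)).symm y ∉ K → h y = 0) :
    ContinuousOn ((e.extend (𝓡∂ 2)).target.indicator h) (range (𝓡∂ 2)) := by
  intro y hyr
  by_cases hy : y ∈ (e.extend (𝓡∂ 2)).target
  · refine (hc y hy).congr_of_eventuallyEq ?_ (indicator_of_mem hy h)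
    filter_upwards [target_mem_nhdsWithin hy] with z hz
    exact indicator_of_mem hz h
  · have : (e.extend (𝓡∂ 2)).target.indicator h =ᶠ[𝓝 y] fun _ => 0 := by
      filter_upwards [eventually_symm_notMem hK hKe hy] with z hz
      by_cases hzt : z ∈ (e.extend (𝓡∂ 2)).target
      · rw [indicator_of_mem hzt, h0 z hzt (hz hzt)]
      · exact indicator_of_notMem hzt h
    exact (continuousAt_const.congr this.symm).continuousWithinAt

theorem indicator_eventuallyEq_zero (hK : IsCompact K) (hKe : K ⊆ e.source) {h : E2 → ℝ}
    (h0 : ∀ y ∈ (e.extend (𝓡∂ 2)).target, (e.extend (𝓡∂ 2)).symm y ∉ K → h y = 0) {y : E2}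
    (hy : y ∉ (e.extend (𝓡∂ 2)).target) :
    (e.extend (𝓡∂ 2)).target.indicator h =ᶠ[𝓝 y] fun _ => 0 := by
  filter_upwards [eventually_symm_notMem hK hKe hy] with z hz
  by_cases hzt : z ∈ (e.extend (𝓡∂ 2)).target
  · rw [indicator_of_mem hzt, h0 z hzt (hz hzt)]
  · exact indicator_of_notMem hzt h

theorem surfGrad_eq_zero {f : M → ℝ} {p : M} (hp : p ∉ tsupport f) : surfGrad x f p = 0 := by
  have h : f =ᶠ[𝓝 p] fun _ => 0 := notMem_tsupport_iff_eventuallyEq.1 hp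
  have h2 : diffAt f p = 0 := by
    rw [diffAt, h.mfderiv_eq]
    exact mfderiv_const
  simp [surfGrad, h2]

theorem jacobiForm_eq_zero {a : E3} {f : M → ℝ} {p : M} (hp : p ∉ tsupport f) :
    jacobiForm x N a f p = 0 := by
  rw [jacobiForm, surfGrad_eq_zero hp, image_eq_zero_of_notMem_tsupport hp]
  simp

/-- Integration by parts in a chart. -/
theorem integral_orientedDensity_mul_jacobiForm (he : e ∈ atlas (EuclideanHalfSpace 2) M)
    (hx : IsImmersedSurface Ω x N) {H : ℝ} (hH : ∀ p, meanCurvature x N p = H) (a : E3) {f : M → ℝ}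
    (hf : ContMDiff (𝓡∂ 2) 𝓘(ℝ, ℝ) ∞ f) (hK : IsCompact (tsupport f)) (hKe : tsupport f ⊆ e.source) :
    ∫ y in (e.extend (𝓡∂ 2)).target,
      orientedDensity x N e y * jacobiForm x N a f ((e.extend (𝓡∂ 2)).symm y) =
    -∫ s, (e.extend (𝓡∂ 2)).target.indicator
      (fun y => f ((e.extend (𝓡∂ 2)).symm y) * flux x N e H a 1 y) (edgePt s) := by
  set T := (e.extend (𝓡∂ 2)).target with hT
  set v : E2 → ℝ := fun y => f ((e.extend (𝓡∂ 2)).symm y) * flux x N e H a 1 y with hv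
  set w : E2 → ℝ := fun y => f ((e.extend (𝓡∂ 2)).symm y) * -flux x N e H a 0 y with hw
  set d : E2 → ℝ := fun y =>
    orientedDensity x N e y * jacobiForm x N a f ((e.extend (𝓡∂ 2)).symm y) with hd
  have hv0 : ∀ y ∈ T, (e.extend (𝓡∂ 2)).symm y ∉ tsupport f → v y = 0 := fun y _ h => by
    simp only [hv]; rw [image_eq_zero_of_notMem_tsupport h, zero_mul]
  have hw0 : ∀ y ∈ T, (e.extend (𝓡∂ 2)).symm y ∉ tsupport f → w y = 0 := fun y _ h => by
    simp only [hw]; rw [image_eq_zero_of_notMem_tsupport h, zero_mul]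
  have hd0 : ∀ y ∈ T, (e.extend (𝓡∂ 2)).symm y ∉ tsupport f → d y = 0 := fun y _ h => by
    simp only [hd]; rw [jacobiForm_eq_zero h, mul_zero]
  have hfc : ∀ y ∈ T, ContinuousWithinAt (fun y => f ((e.extend (𝓡∂ 2)).symm y))
      (range (𝓡∂ 2)) y := fun y hy => (contDiffWithinAt_chart he hf hy).continuousWithinAt
  have hvc := continuousOn_indicator hK hKe
    (fun y hy => (hfc y hy).mul (continuousWithinAt_flux he hx H a 1 hy)) hv0
  have hwc := continuousOn_indicator hK hKe
    (fun y hy => (hfc y hy).mul (continuousWithinAt_flux he hx H a 0 hy).neg) hw0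
  have hdc := continuousOn_indicator hK hKe
    (fun y hy => (continuousWithinAt_orientedDensity he hx hy).mul
      (((continuous_jacobiForm hx a hf).tendsto _).comp
        (e.continuousAt_extend_symm' hy).continuousWithinAt)) hd0
  have hnhds : ∀ y ∈ T, y ∈ interior (range (𝓡∂ 2)) → T ∈ 𝓝 y := fun y hy hyi => by
    have := target_mem_nhdsWithin hy
    rwa [nhdsWithin_eq_nhds.2 (mem_interior_iff_mem_nhds.1 hyi)] at this
  have hder : ∀ y ∈ T, y ∈ interior (range (𝓡∂ 2)) → ∃ v' w' : E2 →L[ℝ] ℝ,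
      HasFDerivAt (T.indicator v) v' y ∧ HasFDerivAt (T.indicator w) w' y ∧
      v' (coordVec 0) + w' (coordVec 1) = d y := by
    intro y hy hyi
    have hr := mem_interior_iff_mem_nhds.1 hyi
    obtain ⟨P', hP, hP'⟩ := exists_hasFDerivWithinAt_flux he hx H a 1 hy
    obtain ⟨R', hR, hR'⟩ := exists_hasFDerivWithinAt_flux he hx H a 0 hy
    have hF := (hasFDerivWithinAt_chart he hf hy).hasFDerivAt hr
    have h1 := hF.mul (hP.hasFDerivAt hr)
    have h2 := hF.mul (hR.hasFDerivAt hr).neg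
    have e1 : ∀ g : E2 → ℝ, T.indicator g =ᶠ[𝓝 y] g := fun g => by
      filter_upwards [hnhds y hy hyi] with z hz
      exact indicator_of_mem hz g
    refine ⟨_, _, h1.congr_of_eventuallyEq (e1 v), h2.congr_of_eventuallyEq (e1 w), ?_⟩
    simp only [hd]
    rw [orientedDensity_mul_jacobiForm he hx hH a hf hy]
    simp only [add_apply, smul_apply, neg_apply, Pi.neg_apply, smul_eq_mul, Function.comp_apply, hP', hR']
    -- Symmetry of the second derivatives removes them from ∂₀P₁ - ∂₁P₀. Antisymmetry of the triple
    -- product makes the remaining terms add up, whence the factor 2 in front of det(a, N₀, N₁).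
    rw [fderivWithin_chartD_symm he hx.smooth hy (coordVec 0) (coordVec 1),
      fderivWithin_chartD_symm he hx.smooth_normal hy (coordVec 0) (coordVec 1),
      triple_swap a (chartD N e y (coordVec 1)) (chartD x e y (coordVec 0)),
      triple_swap a (chartD N e y (coordVec 1)) (chartD N e y (coordVec 0))]
    simp only [flux]
    ring
  have hder0 : ∀ y ∉ T, HasFDerivAt (T.indicator v) (0 : E2 →L[ℝ] ℝ) y ∧
      HasFDerivAt (T.indicator w) (0 : E2 →L[ℝ] ℝ) y := fun y hy =>
    ⟨(hasFDerivAt_const (0 : ℝ) y).congr_of_eventuallyEq (indicator_eventuallyEq_zero hK hKe hv0 hy),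
      (hasFDerivAt_const (0 : ℝ) y).congr_of_eventuallyEq (indicator_eventuallyEq_zero hK hKe hw0 hy)⟩
  obtain ⟨R, hR⟩ : ∃ R, ∀ y ∈ e.extend (𝓡∂ 2) '' tsupport f, ‖y‖ ≤ R :=
    (hK.image_of_continuousOn
      (e.continuousOn_extend.mono (by rwa [e.extend_source]))).isBounded.exists_norm_le
  -- The radius |R| + 1 is positive and exceeds `R`, whatever the sign of the bound `R`, which may
  -- be negative when the support is empty.
  have hfar : ∀ g : E2 → ℝ, (∀ y ∈ T, (e.extend (𝓡∂ 2)).symm y ∉ tsupport f → g y = 0) →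
      ∀ y, |R| + 1 ≤ ‖y‖ → T.indicator g y = 0 := fun g hg y hyR => by
    by_cases hy : y ∈ T
    · rw [indicator_of_mem hy]
      refine hg y hy fun hmem => ?_
      have := hR y ⟨_, hmem, (e.extend (𝓡∂ 2)).right_inv hy⟩
      linarith [le_abs_self R]
    · exact indicator_of_notMem hy g
  have key := integral_divergence_halfPlane (V := T.indicator v) (W := T.indicator w)
    (d := T.indicator d) (V' := fderiv ℝ (T.indicator v)) (W' := fderiv ℝ (T.indicator w))
    (R := |R| + 1) hvc hwc hdc ?_ ?_ ?_ (by positivity)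
    (fun y _ hyR => ⟨hfar v hv0 y hyR, hfar w hw0 y hyR, hfar d hd0 y hyR⟩)
  · rw [← key, setIntegral_indicator (measurableSet_extend_target e),
      inter_eq_self_of_subset_right e.extend_target_subset_range]
  · intro y hyi
    by_cases hy : y ∈ T
    · obtain ⟨v', w', h1, h2, h3⟩ := hder y hy hyi
      exact h1.differentiableAt.hasFDerivAt
    · exact (hder0 y hy).1.differentiableAt.hasFDerivAt
  · intro y hyi
    by_cases hy : y ∈ T
    · obtain ⟨v', w', h1, h2, h3⟩ := hder y hy hyi
      exact h2.differentiableAt.hasFDerivAt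
    · exact (hder0 y hy).2.differentiableAt.hasFDerivAt
  · intro y hyi
    by_cases hy : y ∈ T
    · obtain ⟨v', w', h1, h2, h3⟩ := hder y hy hyi
      rw [h1.fderiv, h2.fderiv, h3, indicator_of_mem hy]
    · rw [(hder0 y hy).1.fderiv, (hder0 y hy).2.fderiv, indicator_of_notMem hy]
      simp

/-- Near each point the area density is the oriented density up to a fixed sign. -/
theorem exists_orientation (he : e ∈ atlas (EuclideanHalfSpace 2) M) (hx : IsImmersedSurface Ω x N)
    {p : M} (hp : p ∈ e.source) : ∃ U : Set M, IsOpen U ∧ p ∈ U ∧ U ⊆ e.source ∧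
      ∃ ε : ℝ, |ε| = 1 ∧ ∀ y ∈ (e.extend (𝓡∂ 2)).target, (e.extend (𝓡∂ 2)).symm y ∈ U →
        √(gram (chartD x e y)).det = ε * orientedDensity x N e y := by
  -- The square of the oriented density is det g > 0, so this continuous function never vanishes and
  -- keeps its sign near each point.
  have hsq : ∀ y ∈ (e.extend (𝓡∂ 2)).target,
      √(gram (chartD x e y)).det = |orientedDensity x N e y| ∧ orientedDensity x N e y ≠ 0 := by
    intro y hy
    have h := triple_normal_sq_eq_det (hx.norm_normal ((e.extend (𝓡∂ 2)).symm y))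
      (inner_normal_chartD' he hx hy)
    have hpos := gram_det_pos (chartD_injective' he hx hy)
    rw [← h] at hpos ⊢
    exact ⟨Real.sqrt_sq_eq_abs _, fun h0 => by
      rw [orientedDensity] at h0; rw [h0] at hpos; norm_num at hpos⟩
  have hc : ContinuousAt (fun q => orientedDensity x N e (e.extend (𝓡∂ 2) q)) p := by
    have h2 : Tendsto (e.extend (𝓡∂ 2)) (𝓝 p) (𝓝[range (𝓡∂ 2)] (e.extend (𝓡∂ 2) p)) :=
      tendsto_nhdsWithin_iff.2 ⟨e.continuousAt_extend hp, Eventually.of_forall fun q => ⟨e q, rfl⟩⟩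
    exact (continuousWithinAt_orientedDensity he hx (extend_mem_target hp)).tendsto.comp h2
  have hne := (hsq _ (extend_mem_target hp)).2
  rcases lt_or_gt_of_ne hne with hlt | hgt
  · obtain ⟨U, hU, hUo, hpU⟩ := mem_nhds_iff.1
      (inter_mem (e.open_source.mem_nhds hp) (hc.eventually (Iio_mem_nhds hlt)))
    refine ⟨U, hUo, hpU, fun q hq => (hU hq).1, -1, by simp, fun y hy hyU => ?_⟩
    have h : orientedDensity x N e (e.extend (𝓡∂ 2) ((e.extend (𝓡∂ 2)).symm y)) < 0 := (hU hyU).2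
    rw [(e.extend (𝓡∂ 2)).right_inv hy] at h
    rw [(hsq y hy).1, abs_of_neg h]; ring
  · obtain ⟨U, hU, hUo, hpU⟩ := mem_nhds_iff.1
      (inter_mem (e.open_source.mem_nhds hp) (hc.eventually (Ioi_mem_nhds hgt)))
    refine ⟨U, hUo, hpU, fun q hq => (hU hq).1, 1, by simp, fun y hy hyU => ?_⟩
    have h : 0 < orientedDensity x N e (e.extend (𝓡∂ 2) ((e.extend (𝓡∂ 2)).symm y)) := (hU hyU).2
    rw [(e.extend (𝓡∂ 2)).right_inv hy] at h
    rw [(hsq y hy).1, abs_of_pos h]; ring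

/-! ### The boundary estimate for the Jacobi form in one chart. -/

variable [MeasurableSpace M] [BorelSpace M] [CompactSpace M]

/-- Integration by parts leaves an edge integral of f P₁. The constant depends on `K` but not on f,
which permits passing to a limit of test functions. -/
theorem exists_local_bound (he : e ∈ atlas (EuclideanHalfSpace 2) M) (hx : IsImmersedSurface Ω x N)
    {H : ℝ} (hH : ∀ p, meanCurvature x N p = H) (a : E3) {U : Set M} (hUe : U ⊆ e.source)
    {ε : ℝ} (hε : |ε| = 1) (hU : ∀ y ∈ (e.extend (𝓡∂ 2)).target, (e.extend (𝓡∂ 2)).symm y ∈ U →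
        √(gram (chartD x e y)).det = ε * orientedDensity x N e y)
    {K : Set M} (hK : IsCompact K) (hKU : K ⊆ U) :
    ∃ C, ∀ f : M → ℝ, ContMDiff (𝓡∂ 2) 𝓘(ℝ, ℝ) ∞ f → tsupport f ⊆ K →
      |∫ p, jacobiForm x N a f p ∂(area x)| ≤ C * ∫ p, |f p| ∂(bdryLength x) := by
  have hKe : K ⊆ e.source := hKU.trans hUe
  have hKc : IsCompact (e.extend (𝓡∂ 2) '' K) :=
    hK.image_of_continuousOn (e.continuousOn_extend.mono (by rwa [e.extend_source]))
  have hsub : e.extend (𝓡∂ 2) '' K ⊆ (e.extend (𝓡∂ 2)).target := by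
    rintro _ ⟨p, hp, rfl⟩
    exact extend_mem_target (hKe hp)
  have hpos : ∀ y ∈ (e.extend (𝓡∂ 2)).target, ‖chartD x e y (coordVec 1)‖ ≠ 0 := fun y hy h =>
    coordVec_ne_zero 1 (chartD_injective' he hx hy (by rw [norm_eq_zero.1 h, map_zero]))
  -- C bounds the flux relative to the length density on the chart image of K. The quotient is
  -- continuous because ∂ₛx never vanishes.
  obtain ⟨C, hC⟩ := hKc.exists_bound_of_continuousOn
    (f := fun y => flux x N e H a 1 y / ‖chartD x e y (coordVec 1)‖) (fun y hy =>
      ((continuousWithinAt_flux he hx H a 1 (hsub hy)).mono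
        (hsub.trans e.extend_target_subset_range)).div
      ((continuousOn_length_density he hx.smooth y (hsub hy)).mono hsub) (hpos y (hsub hy)))
  refine ⟨|C|, fun f hf hfK => ?_⟩
  have hcomp : IsCompact (tsupport f) := hK.of_isClosed_subset (isClosed_tsupport f) hfK
  have h1 : ∫ p, jacobiForm x N a f p ∂(area x) = ε * ∫ y in (e.extend (𝓡∂ 2)).target,
      orientedDensity x N e y * jacobiForm x N a f ((e.extend (𝓡∂ 2)).symm y) := by
    rw [integral_area_eq he hx.smooth (continuous_jacobiForm hx a hf)
      (fun p hp => jacobiForm_eq_zero fun h => hp (hKe (hfK h))), ← integral_const_mul]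
    refine setIntegral_congr_fun (measurableSet_extend_target e) fun y hy => ?_
    by_cases hyf : (e.extend (𝓡∂ 2)).symm y ∈ tsupport f
    · rw [hU y hy (hKU (hfK hyf)), mul_assoc]
    · rw [jacobiForm_eq_zero hyf, mul_zero, mul_zero, mul_zero]
  obtain ⟨hint, hle⟩ := integral_edge_le he hx.smooth (f := fun p => |f p|) hf.continuous.abs
    (fun p => abs_nonneg _)
  rw [h1, integral_orientedDensity_mul_jacobiForm he hx hH a hf hcomp (hfK.trans hKe), abs_mul, hε,
    one_mul, abs_neg]
  have hbound : ∀ s, ‖(e.extend (𝓡∂ 2)).target.indicator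
      (fun y => f ((e.extend (𝓡∂ 2)).symm y) * flux x N e H a 1 y) (edgePt s)‖ ≤
      {s | edgePt s ∈ (e.extend (𝓡∂ 2)).target}.indicator (fun s => |C| *
        (‖chartD x e (edgePt s) (coordVec 1)‖ * |f ((e.extend (𝓡∂ 2)).symm (edgePt s))|)) s := by
    intro s
    by_cases hs : edgePt s ∈ (e.extend (𝓡∂ 2)).target
    · rw [indicator_of_mem hs, indicator_of_mem (s := {s | edgePt s ∈ (e.extend (𝓡∂ 2)).target}) hs]
      by_cases hsf : (e.extend (𝓡∂ 2)).symm (edgePt s) ∈ tsupport f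
      · have h2 := hC (edgePt s) ⟨_, hfK hsf, (e.extend (𝓡∂ 2)).right_inv hs⟩
        rw [norm_div, norm_norm, div_le_iff₀
          (lt_of_le_of_ne (norm_nonneg _) (Ne.symm (hpos _ hs)))] at h2
        rw [norm_mul, Real.norm_eq_abs]
        have h3 := h2.trans (mul_le_mul_of_nonneg_right (le_abs_self C) (norm_nonneg _))
        calc _ ≤ |f ((e.extend (𝓡∂ 2)).symm (edgePt s))| *
              (|C| * ‖chartD x e (edgePt s) (coordVec 1)‖) :=
                mul_le_mul_of_nonneg_left h3 (abs_nonneg _)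
          _ = _ := by ring
      · rw [image_eq_zero_of_notMem_tsupport hsf]; simp
    · rw [indicator_of_notMem hs, norm_zero]
      rw [indicator_of_notMem (s := {s | edgePt s ∈ (e.extend (𝓡∂ 2)).target}) hs]
  calc _ ≤ ∫ s, {s | edgePt s ∈ (e.extend (𝓡∂ 2)).target}.indicator (fun s => |C| *
        (‖chartD x e (edgePt s) (coordVec 1)‖ * |f ((e.extend (𝓡∂ 2)).symm (edgePt s))|)) s :=
        norm_integral_le_of_norm_le
          ((integrable_indicator_iff (isOpen_edge e).measurableSet).2 (hint.const_mul |C|))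
          (Eventually.of_forall hbound)
    _ = |C| * ∫ s in {s | edgePt s ∈ (e.extend (𝓡∂ 2)).target},
          ‖chartD x e (edgePt s) (coordVec 1)‖ * |f ((e.extend (𝓡∂ 2)).symm (edgePt s))| := by
        rw [integral_indicator (isOpen_edge e).measurableSet, integral_const_mul]
    _ ≤ _ := mul_le_mul_of_nonneg_left hle (abs_nonneg C)

end Local

/-! ### Global estimates -/

/-- The gradient as a linear map. -/
def gradHom (L : E2 →L[ℝ] E3) : (E2 →L[ℝ] ℝ) →ₗ[ℝ] E3 where
  toFun := gradOf L
  map_add' l k := by simp [gradOf, mul_add, add_smul, Finset.sum_add_distrib]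
  map_smul' c l := by
    simp only [gradOf, smul_apply, smul_eq_mul, RingHom.id_apply, Finset.smul_sum, smul_smul]
    refine Finset.sum_congr rfl fun i _ => Finset.sum_congr rfl fun j _ => ?_
    ring_nf

section Global

variable {M : Type*} [TopologicalSpace M] [ChartedSpace (EuclideanHalfSpace 2) M]
  [IsManifold (𝓡∂ 2) ∞ M] {Ω : Set E3} {x N : M → E3}

theorem surfGrad_sum {ι : Type*} (s : Finset ι) {f : ι → M → ℝ}
    (hf : ∀ i, ContMDiff (𝓡∂ 2) 𝓘(ℝ, ℝ) ∞ (f i)) (p : M) :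
    surfGrad x (fun q => ∑ i ∈ s, f i q) p = ∑ i ∈ s, surfGrad x (f i) p := by
  have hs : ContMDiff (𝓡∂ 2) 𝓘(ℝ, ℝ) ∞ (fun q => ∑ i ∈ s, f i q) :=
    contMDiff_finsetSum fun i _ => hf i
  have hd : diffAt (fun q => ∑ i ∈ s, f i q) p = ∑ i ∈ s, diffAt (f i) p := by
    have hy := mem_extChartAt_target (I := 𝓡∂ 2) p
    have h := HasFDerivWithinAt.fun_sum (u := s) fun i (_ : i ∈ s) =>
      hasFDerivWithinAt_chart (chart_mem_atlas _ p) (hf i) hy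
    simp only [diffAt_eq_chartD hs, diffAt_eq_chartD (hf _)]
    exact h.fderivWithin ((𝓡∂ 2).uniqueDiffOn _ (mem_range_of_mem_target hy))
  change gradHom (diffAt x p) (diffAt _ p) = ∑ i ∈ s, gradHom (diffAt x p) (diffAt (f i) p)
  rw [hd, map_sum]

theorem surfGrad_add_const_mul {f g : M → ℝ} (hf : ContMDiff (𝓡∂ 2) 𝓘(ℝ, ℝ) ∞ f)
    (hg : ContMDiff (𝓡∂ 2) 𝓘(ℝ, ℝ) ∞ g) (c : ℝ) (p : M) :
    surfGrad x (fun q => f q + c * g q) p = surfGrad x f p + c • surfGrad x g p := by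
  have hs : ContMDiff (𝓡∂ 2) 𝓘(ℝ, ℝ) ∞ (fun q => f q + c * g q) :=
    hf.add (contMDiff_const.mul hg)
  have hd : diffAt (fun q => f q + c * g q) p = diffAt f p + c • diffAt g p := by
    have hy := mem_extChartAt_target (I := 𝓡∂ 2) p
    have h := (hasFDerivWithinAt_chart (chart_mem_atlas _ p) hf hy).add
      ((hasFDerivWithinAt_chart (chart_mem_atlas _ p) hg hy).const_mul c)
    simp only [diffAt_eq_chartD hs, diffAt_eq_chartD hf, diffAt_eq_chartD hg]
    exact h.fderivWithin ((𝓡∂ 2).uniqueDiffOn _ (mem_range_of_mem_target hy))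
  change gradHom (diffAt x p) (diffAt _ p) =
    gradHom (diffAt x p) (diffAt f p) + c • gradHom (diffAt x p) (diffAt g p)
  rw [hd, map_add, map_smul]

theorem jacobiForm_sum {ι : Type*} (s : Finset ι) {f : ι → M → ℝ}
    (hf : ∀ i, ContMDiff (𝓡∂ 2) 𝓘(ℝ, ℝ) ∞ (f i)) (a : E3) (p : M) :
    jacobiForm x N a (fun q => ∑ i ∈ s, f i q) p = ∑ i ∈ s, jacobiForm x N a (f i) p := by
  simp only [jacobiForm, surfGrad_sum s hf, sum_inner, Finset.sum_mul, Finset.mul_sum,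
    Finset.sum_sub_distrib]

variable [CompactSpace M] [MeasurableSpace M] [BorelSpace M]

theorem exists_bound {F : Type*} [NormedAddCommGroup F] {f : M → F} (hf : Continuous f) :
    ∃ C, ∀ p, ‖f p‖ ≤ C := by
  obtain ⟨C, hC⟩ := isCompact_univ.exists_bound_of_continuousOn hf.continuousOn
  exact ⟨C, fun p => hC p trivial⟩

theorem memLp_of_continuous {F : Type*} [NormedAddCommGroup F] [SecondCountableTopology F]
    {f : M → F} (hf : Continuous f) (μ : Measure M) [IsFiniteMeasure μ] (r : ENNReal) :
    MemLp f r μ := by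
  borelize F
  obtain ⟨C, hC⟩ := exists_bound hf
  exact MemLp.of_bound hf.aestronglyMeasurable C (Eventually.of_forall hC)

theorem integrable_of_continuous {f : M → ℝ} (hf : Continuous f) (μ : Measure M)
    [IsFiniteMeasure μ] : Integrable f μ :=
  memLp_one_iff_integrable.1 (memLp_of_continuous hf μ 1)

/-- Decompose f = ∑ χᵢ f with a smooth partition of unity subordinate to oriented chart
neighbourhoods. The Jacobi form is linear in f, and |χᵢ f| ≤ |f| restores the boundary integral of f
itself. -/
theorem exists_jacobiForm_bound [T2Space M] (hx : IsImmersedSurface Ω x N) {H : ℝ}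
    (hH : ∀ p, meanCurvature x N p = H) (a : E3) :
    ∃ C, ∀ f : M → ℝ, ContMDiff (𝓡∂ 2) 𝓘(ℝ, ℝ) ∞ f →
      |∫ p, jacobiForm x N a f p ∂(area x)| ≤ C * ∫ p, |f p| ∂(bdryLength x) := by
  have := isFiniteMeasure_area hx.smooth
  have := isFiniteMeasure_bdryLength hx.smooth
  choose U hUo hpU hUs ε hε hU using fun p : M =>
    exists_orientation (chart_mem_atlas (EuclideanHalfSpace 2) p) hx
      (mem_chart_source (EuclideanHalfSpace 2) p)
  obtain ⟨T, -, hT⟩ := (isCompact_univ (X := M)).elim_nhds_subcover U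
    fun p _ => (hUo p).mem_nhds (hpU p)
  obtain ⟨χ, hχ⟩ := SmoothPartitionOfUnity.exists_isSubordinate (𝓡∂ 2) isClosed_univ
    (fun i : T => U i) (fun i => hUo i) (fun p hp => by
      obtain ⟨q, hq, hpq⟩ := mem_iUnion₂.1 (hT hp)
      exact mem_iUnion.2 ⟨⟨q, hq⟩, hpq⟩)
  choose C hC using fun i : T => exists_local_bound (chart_mem_atlas (EuclideanHalfSpace 2) (i : M))
    hx hH a (hUs i) (hε i) (hU i) (isClosed_tsupport (χ i)).isCompact (hχ i)
  refine ⟨∑ i, |C i|, fun f hf => ?_⟩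
  have hχf : ∀ i : T, ContMDiff (𝓡∂ 2) 𝓘(ℝ, ℝ) ∞ (fun p => χ i p * f p) := fun i =>
    (χ i).contMDiff.mul hf
  have hsum : f = fun p => ∑ i : T, χ i p * f p := by
    funext p
    have h1 := χ.sum_eq_one (mem_univ p)
    rw [finsum_eq_sum_of_fintype] at h1
    rw [← Finset.sum_mul, h1, one_mul]
  have hint : ∫ p, jacobiForm x N a f p ∂(area x) =
      ∑ i : T, ∫ p, jacobiForm x N a (fun p => χ i p * f p) p ∂(area x) := by
    rw [← integral_finsetSum _ fun i _ =>
      integrable_of_continuous (continuous_jacobiForm hx a (hχf i)) _]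
    refine integral_congr_ae (Eventually.of_forall fun p => ?_)
    simp only
    rw [← jacobiForm_sum _ hχf, ← hsum]
  rw [hint, Finset.sum_mul]
  refine (Finset.abs_sum_le_sum_abs _ _).trans (Finset.sum_le_sum fun i _ => ?_)
  have h1 := hC i _ (hχf i) (closure_mono fun p hp => left_ne_zero_of_mul hp)
  refine h1.trans ?_
  have h0 : 0 ≤ ∫ p, |χ i p * f p| ∂(bdryLength x) := integral_nonneg fun p => abs_nonneg _
  refine (mul_le_mul_of_nonneg_right (le_abs_self (C i)) h0).trans
    (mul_le_mul_of_nonneg_left ?_ (abs_nonneg _))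
  refine integral_mono (integrable_of_continuous (hχf i).continuous.abs _)
    (integrable_of_continuous hf.continuous.abs _) fun p => ?_
  simp only
  rw [abs_mul, abs_of_nonneg (χ.nonneg i p)]
  exact mul_le_of_le_one_left (abs_nonneg _) (χ.le_one i p)

/-- On a finite measure space L² convergence implies L¹ convergence. That is enough below, since the
functions paired with φ and G are bounded. -/
theorem tendsto_integral_norm_of_eLpNorm {F : Type*} [NormedAddCommGroup F] {μ : Measure M}
    [IsFiniteMeasure μ] {h : ℕ → M → F} (hm : ∀ k, AEStronglyMeasurable (h k) μ)
    (ht : Tendsto (fun k => eLpNorm (h k) 2 μ) atTop (𝓝 0)) :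
    Tendsto (fun k => ∫ p, ‖h k p‖ ∂μ) atTop (𝓝 0) := by
  have h1 : Tendsto (fun k => eLpNorm (h k) 1 μ) atTop (𝓝 0) := by
    have h2 : Tendsto (fun k => eLpNorm (h k) 2 μ *
        μ univ ^ (1 / (1 : ENNReal).toReal - 1 / (2 : ENNReal).toReal)) atTop (𝓝 0) := by
      have h3 := ENNReal.Tendsto.mul_const ht (b := μ univ ^
        (1 / (1 : ENNReal).toReal - 1 / (2 : ENNReal).toReal)) (Or.inr
          (ENNReal.rpow_ne_top_of_nonneg (by norm_num) (measure_ne_top μ univ)))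
      rwa [zero_mul] at h3
    exact tendsto_of_tendsto_of_tendsto_of_le_of_le tendsto_const_nhds h2 (fun k => zero_le)
      fun k => eLpNorm_le_eLpNorm_mul_rpow_measure_univ (by norm_num) (hm k)
  have h4 := (ENNReal.tendsto_toReal ENNReal.zero_ne_top).comp h1
  simp only [ENNReal.toReal_zero] at h4
  refine h4.congr fun k => ?_
  simp only [Function.comp_apply]
  rw [eLpNorm_one_eq_lintegral_enorm, integral_norm_eq_lintegral_enorm (hm k)]

variable {φ t : M → ℝ} {G : M → E3}

theorem integrable_interior (hx : IsImmersedSurface Ω x N) (hφ : IsSobolev x φ G t) :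
    Integrable (fun p => ‖G p‖ ^ 2 - normSqA x N p * φ p ^ 2) (area x) := by
  obtain ⟨C, hC⟩ := exists_bound (continuous_normSqA hx)
  exact (hφ.memLp_grad.integrable_norm_pow two_ne_zero).sub
    (hφ.memLp_fun.integrable_sq.bdd_mul (continuous_normSqA hx).aestronglyMeasurable
      (Eventually.of_forall hC))

theorem integrable_jacobi (hx : IsImmersedSurface Ω x N) (hφ : IsSobolev x φ G t) (a : E3) :
    Integrable (fun p => ⟪G p, surfGrad x (fun q => ⟪a, N q⟫) p⟫
      - normSqA x N p * (φ p * ⟪a, N p⟫)) (area x) := by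
  have := isFiniteMeasure_area hx.smooth
  have hu := contMDiff_inner_normal hx a
  have hgu := continuous_surfGrad hx hu
  have hw : Continuous fun p => normSqA x N p * ⟪a, N p⟫ := (continuous_normSqA hx).mul hu.continuous
  obtain ⟨C₁, hC₁⟩ := exists_bound hgu
  obtain ⟨C₂, hC₂⟩ := exists_bound hw
  refine Integrable.sub ?_ ?_
  · exact ((hφ.memLp_grad.integrable one_le_two).norm.mul_const C₁).mono'
      (hφ.memLp_grad.aestronglyMeasurable.inner hgu.aestronglyMeasurable)
      (Eventually.of_forall fun p => (norm_inner_le_norm _ _).trans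
        (mul_le_mul_of_nonneg_left (hC₁ p) (norm_nonneg _)))
  · refine (((hφ.memLp_fun.integrable one_le_two).bdd_mul hw.aestronglyMeasurable
      (Eventually.of_forall hC₂))).congr (Eventually.of_forall fun p => ?_)
    simp only; ring

/-- Components of the normal are weak solutions of the Jacobi equation. -/
theorem integral_jacobi_eq_zero [T2Space M] (hx : IsImmersedSurface Ω x N) {H : ℝ}
    (hH : ∀ p, meanCurvature x N p = H) (hφ : IsSobolev x φ G t)
    (hzero : ∀ᵐ p ∂(bdryLength x), t p = 0) (a : E3) :
    ∫ p, (⟪G p, surfGrad x (fun q => ⟪a, N q⟫) p⟫ - normSqA x N p * (φ p * ⟪a, N p⟫)) ∂(area x) = 0 := by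
  have := isFiniteMeasure_area hx.smooth
  have := isFiniteMeasure_bdryLength hx.smooth
  have hu := contMDiff_inner_normal hx a
  have hgu := continuous_surfGrad hx hu
  have hw : Continuous fun p => normSqA x N p * ⟪a, N p⟫ := (continuous_normSqA hx).mul hu.continuous
  obtain ⟨C₁, hC₁⟩ := exists_bound hgu
  obtain ⟨C₂, hC₂⟩ := exists_bound hw
  obtain ⟨C, hC⟩ := exists_jacobiForm_bound hx hH a
  obtain ⟨f, hf, hfφ, hfG, hft⟩ := hφ.approx
  have hJ := integrable_jacobi hx hφ a
  set I := ∫ p, (⟪G p, surfGrad x (fun q => ⟪a, N q⟫) p⟫ - normSqA x N p * (φ p * ⟪a, N p⟫))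
    ∂(area x) with hI
  have hm1 : ∀ k, MemLp (fun p => surfGrad x (f k) p - G p) 2 (area x) := fun k =>
    (memLp_of_continuous (continuous_surfGrad hx (hf k)) _ 2).sub hφ.memLp_grad
  have hm2 : ∀ k, MemLp (fun p => f k p - φ p) 2 (area x) := fun k =>
    (memLp_of_continuous (hf k).continuous _ 2).sub hφ.memLp_fun
  have hm3 : ∀ k, MemLp (fun p => f k p - t p) 2 (bdryLength x) := fun k =>
    (memLp_of_continuous (hf k).continuous _ 2).sub hφ.memLp_trace
  have l1 := tendsto_integral_norm_of_eLpNorm (fun k => (hm1 k).aestronglyMeasurable) hfG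
  have l2 := tendsto_integral_norm_of_eLpNorm (fun k => (hm2 k).aestronglyMeasurable) hfφ
  have l3 := tendsto_integral_norm_of_eLpNorm (fun k => (hm3 k).aestronglyMeasurable) hft
  -- The left side does not depend on k, while the right side tends to zero along the smooth
  -- approximations of φ.
  have hbound : ∀ k, |I| ≤ C * (∫ p, ‖f k p - t p‖ ∂(bdryLength x)) +
      (C₁ * (∫ p, ‖surfGrad x (f k) p - G p‖ ∂(area x)) + C₂ * ∫ p, ‖f k p - φ p‖ ∂(area x)) := by
    intro k
    -- As the trace vanishes, the boundary integral of |fₖ| is the L¹ distance of fₖ to the trace.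
    have e1 : ∫ p, |f k p| ∂(bdryLength x) = ∫ p, ‖f k p - t p‖ ∂(bdryLength x) := by
      refine integral_congr_ae ?_
      filter_upwards [hzero] with p hp
      rw [hp, sub_zero, Real.norm_eq_abs]
    have h1 := hC (f k) (hf k)
    rw [e1] at h1
    have hJi := integrable_of_continuous (continuous_jacobiForm hx a (hf k)) (area x)
    have e2 : ‖∫ p, (jacobiForm x N a (f k) p - (⟪G p, surfGrad x (fun q => ⟪a, N q⟫) p⟫
        - normSqA x N p * (φ p * ⟪a, N p⟫))) ∂(area x)‖ ≤
        C₁ * (∫ p, ‖surfGrad x (f k) p - G p‖ ∂(area x)) + C₂ * ∫ p, ‖f k p - φ p‖ ∂(area x) := by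
      rw [← integral_const_mul, ← integral_const_mul,
        ← integral_add (((hm1 k).integrable one_le_two).norm.const_mul _)
          (((hm2 k).integrable one_le_two).norm.const_mul _)]
      refine norm_integral_le_of_norm_le ((((hm1 k).integrable one_le_two).norm.const_mul _).add
          (((hm2 k).integrable one_le_two).norm.const_mul _)) (Eventually.of_forall fun p => ?_)
      have e3 : jacobiForm x N a (f k) p - (⟪G p, surfGrad x (fun q => ⟪a, N q⟫) p⟫
          - normSqA x N p * (φ p * ⟪a, N p⟫)) =
          ⟪surfGrad x (f k) p - G p, surfGrad x (fun q => ⟪a, N q⟫) p⟫ -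
            (normSqA x N p * ⟪a, N p⟫) * (f k p - φ p) := by
        rw [jacobiForm, inner_sub_left]; ring
      rw [e3]
      refine (norm_sub_le _ _).trans (add_le_add ?_ ?_)
      · rw [mul_comm]
        exact (norm_inner_le_norm _ _).trans (mul_le_mul_of_nonneg_left (hC₁ p) (norm_nonneg _))
      · rw [norm_mul]
        exact mul_le_mul_of_nonneg_right (hC₂ p) (norm_nonneg _)
    rw [integral_sub hJi hJ, ← hI, Real.norm_eq_abs] at e2
    have e4 : |I| ≤ |∫ p, jacobiForm x N a (f k) p ∂(area x)| +
        |∫ p, jacobiForm x N a (f k) p ∂(area x) - I| := by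
      have := abs_sub (∫ p, jacobiForm x N a (f k) p ∂(area x))
        (∫ p, jacobiForm x N a (f k) p ∂(area x) - I)
      rwa [sub_sub_cancel] at this
    linarith
  have hlim := (l3.const_mul C).add ((l1.const_mul C₁).add (l2.const_mul C₂))
  simp only [mul_zero, add_zero] at hlim
  exact abs_nonpos_iff.1 (ge_of_tendsto' hlim hbound)

theorem IsSobolev.add_const_mul (hx : IsImmersedSurface Ω x N) (hφ : IsSobolev x φ G t) {v : M → ℝ}
    (hv : ContMDiff (𝓡∂ 2) 𝓘(ℝ, ℝ) ∞ v) (c : ℝ) :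
    IsSobolev x (fun p => φ p + c * v p) (fun p => G p + c • surfGrad x v p)
      (fun p => t p + c * v p) := by
  have := isFiniteMeasure_area hx.smooth
  have := isFiniteMeasure_bdryLength hx.smooth
  obtain ⟨f, hf, hfφ, hfG, hft⟩ := hφ.approx
  refine ⟨hφ.memLp_fun.add (memLp_of_continuous (continuous_const.mul hv.continuous) _ 2),
    hφ.memLp_grad.add (memLp_of_continuous ((continuous_surfGrad hx hv).const_smul c) _ 2),
    hφ.memLp_trace.add (memLp_of_continuous (continuous_const.mul hv.continuous) _ 2),
    fun k p => f k p + c * v p, fun k => (hf k).add (contMDiff_const.mul hv), ?_, ?_, ?_⟩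
  · simpa only [add_sub_add_right_eq_sub] using hfφ
  · simpa only [surfGrad_add_const_mul (hf _) hv, add_sub_add_right_eq_sub] using hfG
  · simpa only [add_sub_add_right_eq_sub] using hft

theorem isSobolev_of_contMDiff (hx : IsImmersedSurface Ω x N) {v : M → ℝ}
    (hv : ContMDiff (𝓡∂ 2) 𝓘(ℝ, ℝ) ∞ v) : IsSobolev x v (surfGrad x v) v := by
  have := isFiniteMeasure_area hx.smooth
  have := isFiniteMeasure_bdryLength hx.smooth
  refine ⟨memLp_of_continuous hv.continuous _ 2, memLp_of_continuous (continuous_surfGrad hx hv) _ 2,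
    memLp_of_continuous hv.continuous _ 2, fun _ => v, fun _ => hv, ?_, ?_, ?_⟩ <;> simp

/-- The cross term of the quadratic expansion is 2c times the weak Jacobi equation for ⟨a, N⟩ tested
with φ. -/
theorem interiorForm_add [T2Space M] (hx : IsImmersedSurface Ω x N) {H : ℝ}
    (hH : ∀ p, meanCurvature x N p = H) (hφ : IsSobolev x φ G t)
    (hzero : ∀ᵐ p ∂(bdryLength x), t p = 0) (a : E3) (c : ℝ) :
    interiorForm x N (fun p => φ p + c * ⟪a, N p⟫)
        (fun p => G p + c • surfGrad x (fun q => ⟪a, N q⟫) p) =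
      interiorForm x N φ G + c ^ 2 *
        interiorForm x N (fun p => ⟪a, N p⟫) (surfGrad x (fun q => ⟪a, N q⟫)) := by
  have h0 := integral_jacobi_eq_zero hx hH hφ hzero a
  have i1 := integrable_interior hx hφ
  have i2 := integrable_jacobi hx hφ a
  have i3 := integrable_interior hx (isSobolev_of_contMDiff hx (contMDiff_inner_normal hx a))
  have e : ∀ p, ‖G p + c • surfGrad x (fun q => ⟪a, N q⟫) p‖ ^ 2
      - normSqA x N p * (φ p + c * ⟪a, N p⟫) ^ 2 =
      (‖G p‖ ^ 2 - normSqA x N p * φ p ^ 2) + (2 * c * (⟪G p, surfGrad x (fun q => ⟪a, N q⟫) p⟫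
        - normSqA x N p * (φ p * ⟪a, N p⟫)) + c ^ 2 * (‖surfGrad x (fun q => ⟪a, N q⟫) p‖ ^ 2
        - normSqA x N p * ⟪a, N p⟫ ^ 2)) := fun p => by
    rw [norm_add_sq_real, norm_smul, real_inner_smul_right, mul_pow, Real.norm_eq_abs, sq_abs]
    ring
  have j2 := i2.const_mul (2 * c)
  have j3 := i3.const_mul (c ^ 2)
  have j23 : Integrable (fun p => 2 * c * (⟪G p, surfGrad x (fun q => ⟪a, N q⟫) p⟫
        - normSqA x N p * (φ p * ⟪a, N p⟫)) + c ^ 2 * (‖surfGrad x (fun q => ⟪a, N q⟫) p‖ ^ 2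
        - normSqA x N p * ⟪a, N p⟫ ^ 2)) (area x) := j2.add j3
  unfold interiorForm
  simp only [e]
  rw [integral_add i1 j23, integral_add j2 j3, integral_const_mul, integral_const_mul, h0]
  ring

end Global

/-! ### The boundary term -/

section Boundary

variable {M : Type*} [TopologicalSpace M] [ChartedSpace (EuclideanHalfSpace 2) M]
  [IsManifold (𝓡∂ 2) ∞ M] {Ω : Set E3} {ρ : E3 → ℝ} {x N : M → E3}

theorem continuousAt_fderiv_outwardNormal (hρ : ContDiff ℝ ∞ ρ) {q : E3} (hq : gradient ρ q ≠ 0) :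
    ContinuousAt (fderiv ℝ (outwardNormal ρ)) q := by
  have hg : ContDiff ℝ ∞ (gradient ρ) :=
    (InnerProductSpace.toDual ℝ E3).symm.contDiff.comp (hρ.fderiv_right (by norm_num))
  have h : ContDiffAt ℝ ∞ (outwardNormal ρ) q :=
    ((hg.contDiffAt.norm ℝ hq).inv (norm_ne_zero_iff.2 hq)).smul hg.contDiffAt
  exact (h.fderiv_right (m := ∞) (by norm_num)).continuousAt

/-- Continuity is claimed only along ∂M: the extended normal is smooth where ∇ρ ≠ 0, and the
frontier of Ω lies in {ρ = 0}, where this holds. -/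
theorem continuousOn_boundaryForm (hΩ : IsSmoothConvexDomain Ω ρ) (hx : IsImmersedSurface Ω x N) :
    ContinuousOn (fun p => boundaryForm ρ (x p) (N p) (N p)) ((𝓡∂ 2).boundary M) := by
  intro p hp
  have hfr := (hx.boundary_iff p).1 hp
  have hρ0 : ρ (x p) = 0 := by
    rw [hΩ.defining.eq_sublevel] at hfr
    exact frontier_le_subset_eq hΩ.defining.smooth.continuous continuous_const hfr
  have h1 := (continuousAt_fderiv_outwardNormal hΩ.defining.smooth
    (hΩ.defining.regular _ hρ0)).comp (hx.smooth.continuous.continuousAt (x := p))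
  have hN := hx.smooth_normal.continuous.continuousAt (x := p)
  exact ((h1.clm_apply hN).inner hN).continuousWithinAt

variable [CompactSpace M] [MeasurableSpace M] [BorelSpace M]

theorem integrable_boundaryForm_mul (hΩ : IsSmoothConvexDomain Ω ρ) (hx : IsImmersedSurface Ω x N)
    {g : M → ℝ} (hg : Continuous g) :
    Integrable (fun p => boundaryForm ρ (x p) (N p) (N p) * g p) (bdryLength x) := by
  have := isFiniteMeasure_bdryLength hx.smooth
  have hc : IsClosed ((𝓡∂ 2).boundary M) :=
    ModelWithCorners.isClosed_boundary (I := 𝓡∂ 2) (n := ∞) (by norm_num)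
  have h1 : ContinuousOn (fun p => boundaryForm ρ (x p) (N p) (N p) * g p) ((𝓡∂ 2).boundary M) :=
    (continuousOn_boundaryForm hΩ hx).mul hg.continuousOn
  obtain ⟨C, hC⟩ := hc.isCompact.exists_bound_of_continuousOn h1
  have h2 : AEStronglyMeasurable (fun p => boundaryForm ρ (x p) (N p) (N p) * g p)
      (bdryLength x) := by
    have := h1.aestronglyMeasurable (μ := bdryLength x) hc.measurableSet
    rwa [Measure.restrict_eq_self_of_ae_mem (ae_mem_boundary x)] at this
  refine Integrable.of_bound h2 C ?_
  filter_upwards [ae_mem_boundary x] with p hp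
  exact hC p hp

/-- Orthogonality says that N is tangent to ∂Ω along ∂M, so strict convexity makes the integrand
positive. The length measure is nonzero because ∂M is nonempty. -/
theorem integral_boundaryForm_pos (hΩ : IsSmoothConvexDomain Ω ρ) (hx : IsImmersedSurface Ω x N)
    (horth : ∀ p ∈ (𝓡∂ 2).boundary M, ⟪N p, outwardNormal ρ (x p)⟫ = 0) :
    0 < ∫ p, boundaryForm ρ (x p) (N p) (N p) ∂(bdryLength x) := by
  have hpos : ∀ᵐ p ∂(bdryLength x), 0 < boundaryForm ρ (x p) (N p) (N p) := by
    filter_upwards [ae_mem_boundary x] with p hp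
    refine hΩ.convex _ ((hx.boundary_iff p).1 hp) _ (by rw [real_inner_comm]; exact horth p hp) ?_
    exact norm_ne_zero_iff.1 (by rw [hx.norm_normal p]; exact one_ne_zero)
  have hint : Integrable (fun p => boundaryForm ρ (x p) (N p) (N p)) (bdryLength x) := by
    simpa using integrable_boundaryForm_mul hΩ hx (g := fun _ => 1) continuous_const
  have hnn : 0 ≤ᵐ[bdryLength x] fun p => boundaryForm ρ (x p) (N p) (N p) :=
    hpos.mono fun p hp => hp.le
  refine lt_of_le_of_ne (integral_nonneg_of_ae hnn) fun h => ?_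
  have h2 := (integral_eq_zero_iff_of_nonneg_ae hnn hint).1 h.symm
  have h3 : ∀ᵐ p ∂(bdryLength x), False := by
    filter_upwards [hpos, h2] with p hp hp0
    exact hp.ne' hp0
  rw [eventually_false_iff_eq_bot, ae_eq_bot] at h3
  exact bdryLength_ne_zero hx h3

/-- The sum of `⟨eₐ, N⟩²` is one. -/
theorem sum_inner_normal_sq (hx : IsImmersedSurface Ω x N) (p : M) :
    ∑ a : Fin 3, ⟪EuclideanSpace.single a (1 : ℝ), N p⟫ ^ 2 = 1 := by
  have h := real_inner_self_eq_norm_sq (N p)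
  rw [hx.norm_normal, inner_eq_coords] at h
  simp [Fin.sum_univ_three, inner_eq_coords]
  linear_combination h

/-- The index form is negative on some component of the normal. -/
theorem exists_indexForm_neg (hΩ : IsSmoothConvexDomain Ω ρ) (hx : IsImmersedSurface Ω x N)
    (horth : ∀ p ∈ (𝓡∂ 2).boundary M, ⟪N p, outwardNormal ρ (x p)⟫ = 0) :
    ∃ a : E3, indexForm ρ x N (fun p => ⟪a, N p⟫) (surfGrad x (fun q => ⟪a, N q⟫))
      (fun p => ⟪a, N p⟫) < 0 := by
  by_contra! hall
  have hsum := Finset.sum_nonneg fun (i : Fin 3) (_ : i ∈ Finset.univ) =>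
    hall (EuclideanSpace.single i 1)
  have hu := contMDiff_inner_normal hx
  have hb : ∀ i : Fin 3, Integrable (fun p => boundaryForm ρ (x p) (N p) (N p) *
      ⟪EuclideanSpace.single i (1 : ℝ), N p⟫ ^ 2) (bdryLength x) := fun i =>
    integrable_boundaryForm_mul hΩ hx ((hu (EuclideanSpace.single i 1)).continuous.pow 2)
  -- Summing over the coordinate vectors, the interior integrand becomes |A|² - |A|² · 1 = 0 and the
  -- boundary integrand Π(N, N). A nonnegative sum would contradict the positivity of ∫ Π(N, N) dl.
  simp only [indexForm, Finset.sum_sub_distrib, interiorForm] at hsum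
  rw [← integral_finsetSum _ fun i _ => integrable_interior hx (isSobolev_of_contMDiff hx (hu _)),
    ← integral_finsetSum _ fun i _ => hb i] at hsum
  simp only [Finset.sum_sub_distrib, ← Finset.mul_sum, sum_norm_surfGrad_sq hx,
    sum_inner_normal_sq hx, mul_one, sub_self, integral_zero, zero_sub] at hsum
  linarith [integral_boundaryForm_pos hΩ hx horth]

end Boundary

end FreeBoundary

end

/-! ### Conclusion: comparison of φ with a component of the normal. -/

theorem proposition1 {M : Type*} [TopologicalSpace M] [T2Space M] [CompactSpace M]
    [ChartedSpace (EuclideanHalfSpace 2) M] [IsManifold (𝓡∂ 2) ∞ M]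
    [MeasurableSpace M] [BorelSpace M]
    (Ω : Set E3) (ρ : E3 → ℝ) (hΩ : IsSmoothConvexDomain Ω ρ)
    (x N : M → E3) (hx : IsImmersedSurface Ω x N) (hstable : IsStableCMC ρ x N)
    (φ : M → ℝ) (G : M → E3) (t : M → ℝ) (hφ : IsSobolev x φ G t)
    (hzero : ∀ᵐ p ∂(bdryLength x), t p = 0) :
    0 ≤ interiorForm x N φ G := by
  have := isFiniteMeasure_area hx.smooth
  obtain ⟨H, hH⟩ := hstable.const_meanCurvature
  obtain ⟨a, ha⟩ := exists_indexForm_neg hΩ hx hstable.orthogonal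
  have hu := contMDiff_inner_normal hx a
  -- A component of mean zero would be an admissible test function with negative index form.
  have hmean : ∫ p, ⟪a, N p⟫ ∂(area x) ≠ 0 := fun h =>
    absurd (hstable.stable _ _ _ (isSobolev_of_contMDiff hx hu) h) (not_le.2 ha)
  -- The coefficient for which φ + c⟨a, N⟩ has mean zero.
  set c : ℝ := -(∫ p, φ p ∂(area x)) / ∫ p, ⟪a, N p⟫ ∂(area x) with hc
  have hstab := hstable.stable _ _ _ (hφ.add_const_mul hx hu c) (by
    rw [integral_add (hφ.memLp_fun.integrable one_le_two)
      ((integrable_of_continuous hu.continuous _).const_mul c), integral_const_mul, hc,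
      div_mul_cancel₀ _ hmean]
    ring)
  have hbdry : ∫ p, boundaryForm ρ (x p) (N p) (N p) * (t p + c * ⟪a, N p⟫) ^ 2 ∂(bdryLength x) =
      c ^ 2 * ∫ p, boundaryForm ρ (x p) (N p) (N p) * ⟪a, N p⟫ ^ 2 ∂(bdryLength x) := by
    rw [← integral_const_mul]
    refine integral_congr_ae ?_
    filter_upwards [hzero] with p hp
    rw [hp]; ring
  rw [indexForm, interiorForm_add hx hH hφ hzero a c, hbdry] at hstab
  rw [indexForm] at ha
  -- The inequality from stability now reads 0 ≤ Q⁰(φ, φ) + c² Q(u, u) with u = ⟨a, N⟩, and the last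
  -- term is nonpositive.
  nlinarith [mul_nonpos_of_nonneg_of_nonpos (sq_nonneg c) ha.le]
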